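/- Let $n,m$ be positive integers and let the row-column symmetry group $\mathrm{Sym}([n])\times\mathrm{Sym}([m])$ act on the set $[n]\times[m]$ of positions of an $n\times m$ matrix of Boolean variables $x_{ij}$, the first factor permuting the rows and the second the columns. A complete symmetry breaking predicate for this group is a CNF formula $\psi$ in the variables $x_{ij}$ such that each orbit $O$ of the induced action on the set of complete assignments $[n]\times[m]\to\{0,1\}$ contains some $\tau\in O$ that satisfies $\psi$, while every $\tau'\in O$ with $\tau'\neq\tau$ falsifies $\psi$. Theorem. Suppose that there is an algorithm which, given any positive integers $n$ and $m$ (in unary), outputs in time polynomial in $n+m$ a complete symmetry breaking predicate for the row-column symmetry group $\mathrm{Sym}([n])\times\mathrm{Sym}([m])$. Then $\mathrm{GI}\in\mathsf{coNP}$, where $\mathrm{GI}$ is the problem of deciding whether two given finite simple undirected graphs (given by their adjacency matrices) are isomorphic; that is, graph non-isomorphism admits a nondeterministic polynomial-time algorithm. -/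

import Mathlib

namespace SymBreak

/-! ### The classes NP and coNP, over Mathlib's multi-stack Turing machines -/

/-- A pair of binary words `(x, c)` as one word, with `none` as a separator. -/
def encodePair (p : List Bool × List Bool) : List (Option Bool) :=
  p.1.map some ++ none :: p.2.map some

/-- A language is in NP if some polynomial time verifier `V` accepts exactly its words,
given a suitable certificate of polynomially bounded length. -/
def NP : Set (Set (List Bool)) :=
  {L | ∃ (p : Polynomial ℕ) (V : List Bool × List Bool → Bool),
    Nonempty (Turing.TM2ComputableInPolyTime encodePair Computability.encodeBool V) ∧
    ∀ x : List Bool, x ∈ L ↔ ∃ c : List Bool, c.length ≤ p.eval x.length ∧ V (x, c) = true}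

/-- A language is in coNP if its complement is in NP. -/
def coNP : Set (Set (List Bool)) := {L | Lᶜ ∈ NP}

/-! ### Graph isomorphism -/

/-- The natural number `k` as the self-delimiting word `1ᵏ0`. -/
def encodeUnary (k : ℕ) : List Bool := List.replicate k true ++ [false]

open Classical in
/-- A graph on `n` vertices as the word `1ⁿ0` followed by the `n * n` entries of its adjacency
matrix, row by row. -/
noncomputable def encodeGraph {n : ℕ} (G : SimpleGraph (Fin n)) : List Bool :=
  encodeUnary n ++
    (List.finRange n).flatMap fun i => (List.finRange n).map fun j => decide (G.Adj i j)

/-- The graph isomorphism problem: the words that encode a pair of isomorphic graphs. -/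
def GI : Set (List Bool) :=
  {w | ∃ (n k : ℕ) (G : SimpleGraph (Fin n)) (H : SimpleGraph (Fin k)),
    w = encodeGraph G ++ encodeGraph H ∧ Nonempty (G ≃g H)}

/-! ### Formulas in conjunctive normal form -/

/-- A literal: a variable together with its sign (`true` for the variable itself, `false` for its
negation). -/
abbrev Literal (Ω : Type) := Ω × Bool

/-- A clause, as the list of its literals. -/
abbrev Clause (Ω : Type) := List (Literal Ω)

/-- A formula in conjunctive normal form with variables in `Ω`, as the list of its clauses. -/
abbrev CNF (Ω : Type) := List (Clause Ω)

/-- The complete assignment `θ` satisfies `ψ`: each clause contains a true literal. -/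
def CNF.IsSatisfiedBy {Ω : Type} (ψ : CNF Ω) (θ : Ω → Bool) : Prop :=
  ∀ C ∈ ψ, ∃ l ∈ C, θ l.1 = l.2

/-- The complete assignment `θ` is conflicting for `ψ`: all literals of some clause are false. -/
def CNF.IsConflicting {Ω : Type} (ψ : CNF Ω) (θ : Ω → Bool) : Prop :=
  ∃ C ∈ ψ, ∀ l ∈ C, θ l.1 ≠ l.2

/-- A variable `x i j` of an `n × m` matrix as the word `1ⁱ01ʲ0`, indices starting at `0`. -/
def encodeVar {n m : ℕ} (v : Fin n × Fin m) : List Bool :=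
  encodeUnary v.1 ++ encodeUnary v.2

/-- A list as a word: each entry is preceded by `1`, and the list is closed by `0`. -/
def encodeList {α : Type} (e : α → List Bool) (l : List α) : List Bool :=
  (l.flatMap fun a => true :: e a) ++ [false]

/-- A formula in the variables of an `n × m` matrix as a word; a literal is its sign followed by
its variable. -/
def encodeCNF {n m : ℕ} (ψ : CNF (Fin n × Fin m)) : List Bool :=
  encodeList (encodeList fun l => l.2 :: encodeVar l.1) ψ

/-! ### Symmetry breaking -/

/-- The orbit of the assignment `θ` under the permutation group `G`. -/
def assignmentOrbit {Ω : Type} (G : Subgroup (Equiv.Perm Ω)) (θ : Ω → Bool) : Set (Ω → Bool) :=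
  {τ | ∃ g ∈ G, τ = θ ∘ ⇑(g⁻¹)}

/-- `ψ` is a complete symmetry breaking predicate for `G`: in each orbit of complete assignments
there is one that satisfies `ψ`, and all the others are conflicting. -/
def IsCompleteSBP {Ω : Type} (G : Subgroup (Equiv.Perm Ω)) (ψ : CNF Ω) : Prop :=
  ∀ θ : Ω → Bool, ∃ τ ∈ assignmentOrbit G θ, ψ.IsSatisfiedBy τ ∧
    ∀ τ' ∈ assignmentOrbit G θ, τ ≠ τ' → ψ.IsConflicting τ'

/-- The row-column symmetry group `Sym(n) × Sym(m)` of an `n × m` matrix, as a group of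
permutations of the set of its positions. -/
def rowColumnGroup (n m : ℕ) : Subgroup (Equiv.Perm (Fin n × Fin m)) where
  carrier := {g | ∃ (σ : Equiv.Perm (Fin n)) (π : Equiv.Perm (Fin m)), g = Equiv.prodCongr σ π}
  one_mem' := ⟨1, 1, rfl⟩
  mul_mem' := by
    rintro _ _ ⟨σ, π, rfl⟩ ⟨σ', π', rfl⟩
    exact ⟨σ * σ', π * π', rfl⟩
  inv_mem' := by
    rintro _ ⟨σ, π, rfl⟩
    exact ⟨σ⁻¹, π⁻¹, rfl⟩

/-- The format `(n, m)` of a matrix as the word `1ⁿ01ᵐ0`; it is unary, so that polynomial time means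
time polynomial in `n` and `m`. -/
def encodeFormat (p : ℕ+ × ℕ+) : List Bool :=
  encodeUnary p.1 ++ encodeUnary p.2

/-- There is a polynomial time algorithm that, given positive integers `n` and `m`, generates a
complete symmetry breaking predicate for the row-column symmetries of an `n × m` matrix. -/
def RowColumnSBPInPolyTime : Prop :=
  ∃ δ : (n m : ℕ+) → CNF (Fin n × Fin m),
    (∀ n m : ℕ+, IsCompleteSBP (rowColumnGroup n m) (δ n m)) ∧
    Nonempty (Turing.TM2ComputableInPolyTime encodeFormat id
      fun p : ℕ+ × ℕ+ => encodeCNF (δ p.1 p.2))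

end SymBreak

/-! To a graph on `n` vertices belongs its incidence matrix with `n` rows and one column for each of
the `n * n` ordered pairs of vertices; columns of non-adjacent pairs vanish, so the format depends
on `n` alone. Two graphs are isomorphic exactly when their matrices lie in one orbit of the
row-column group (`incidence_mem_orbit_iff`). The column of an edge has its two ones at the ends of
that edge, so a row and column permutation that matches the matrices also matches edges.

A complete symmetry breaking predicate `ψ` is satisfied by exactly one matrix of each orbit. A
certificate of non-isomorphism therefore consists of row and column permutations for both graphs.
The verifier obtains `ψ` from the assumed algorithm, permutes both incidence matrices, and accepts
if the results differ and both satisfy `ψ`. For isomorphic graphs the two results lie in one orbit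
and cannot both satisfy `ψ` while being different (`not_accept_of_iso`). For non-isomorphic graphs
the satisfying representatives of the two orbits are different, and permutations leading to them
form a valid certificate (`exists_accept_of_not_iso`).

The rest of the proof shows that this verifier runs in polynomial time on stack machines. Structured
programs over stacks, with the assumed algorithm as a subroutine, are compiled to such machines step
by step (`Runs.reachesIn`). On top of them stands a calculus of polynomial time functions with unary
values, generated by bounded recursion (`PT.natRec`) and by access to the letters of words
(`PTP.bit`). It is closed under arithmetic, connectives and bounded quantifiers, so the condition
`Accept` is polynomial time by its syntactic form (`ptp_accept`). `nonempty_computable_of_call`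
joins this with the single subroutine call; there the predicate has polynomial length because a
machine pushes boundedly many symbols per step. -/

namespace SymBreak

open Turing Function

/-! ### Structured programs over stacks, and their compilation to stack machines -/

/-- The alphabet of the registers: bits and a separator. -/
abbrev Sym := Option Bool

/-- A store assigns a stack of symbols to each register. -/
abbrev Store := ℕ → List Sym

/-- Structured programs: `case r p` pops register `r` and continues with the branch for the popped
symbol, `loop r p` does so until `r` is empty, and `call i o` runs the subroutine. -/
inductive Prog
  | skip : Prog
  | push (r : ℕ) (a : Sym) : Prog
  | seq (p q : Prog) : Prog
  | case (r : ℕ) (p : Option Sym → Prog) : Prog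
  | loop (r : ℕ) (p : Sym → Prog) : Prog
  | call (i o : ℕ) : Prog

section Compile

variable (C : TM2ComputableAux Bool Bool)

/-- `Runs C p s t s'`: started in the store `s`, the program `p` ends in the store `s'` after at
most `t` steps, where `C` is the subroutine. -/
inductive Runs : Prog → Store → ℕ → Store → Prop
  | skip (s) : Runs .skip s 1 s
  | push (r a s) : Runs (.push r a) s 1 (update s r (a :: s r))
  | seq {p q s t s' t' s''} : Runs p s t s' → Runs q s' t' s'' → Runs (.seq p q) s (t + t') s''
  | case {r p s t s'} : Runs (p (s r).head?) (update s r (s r).tail) t s' →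
      Runs (.case r p) s (t + 1) s'
  | loop_nil {r p s} : s r = [] → Runs (.loop r p) s 1 s
  | loop_cons {r p s a l t s' t' s''} : s r = a :: l → Runs (p a) (update s r l) t s' →
      Runs (.loop r p) s' t' s'' → Runs (.loop r p) s (t + 1 + t') s''
  -- Popping one stack and pushing on another reverses a word, so the argument is stored reversed
  -- and the result arrives reversed. Each of the two transfers takes one extra step to notice the
  -- empty stack.
  | call {i o s t} {l l' : List Bool} : s i = (l.map some).reverse →
      Nonempty (TM2OutputsInTime C.tm (l.map C.inputAlphabet.invFun)
        (some (l'.map C.outputAlphabet.invFun)) t) →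
      Runs (.call i o) s (l.length + 1 + t + (l'.length + 1))
        (update (update s i []) o ((l'.map some).reverse ++ update s i [] o))

/-- The labels of the machine code of a program. -/
abbrev Prog.Lab : Prog → Type
  | .skip => Unit
  | .push _ _ => Unit
  | .seq p q => p.Lab ⊕ q.Lab
  | .case _ p => Option (Σ o, (p o).Lab)
  | .loop _ p => Option (Σ a, (p a).Lab)
  | .call _ _ => Bool ⊕ C.tm.Λ

theorem Prog.finite_lab : (p : Prog) → Finite (p.Lab C)
  | .skip => inferInstanceAs (Finite Unit)
  | .push _ _ => inferInstanceAs (Finite Unit)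
  | .seq p q =>
    haveI := p.finite_lab
    haveI := q.finite_lab
    inferInstanceAs (Finite (p.Lab C ⊕ q.Lab C))
  | .case _ p =>
    haveI := fun o => (p o).finite_lab
    inferInstanceAs (Finite (Option (Σ o, (p o).Lab C)))
  | .loop _ p =>
    haveI := fun a => (p a).finite_lab
    inferInstanceAs (Finite (Option (Σ a, (p a).Lab C)))
  | .call _ _ =>
    haveI := C.tm.ΛFin
    inferInstanceAs (Finite (Bool ⊕ C.tm.Λ))

/-- The label at which the machine code of a program is entered. -/
def Prog.entry : (p : Prog) → p.Lab C
  | .skip => ()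
  | .push _ _ => ()
  | .seq p _ => Sum.inl p.entry
  | .case _ _ => (none : Option _)
  | .loop _ _ => (none : Option _)
  | .call _ _ => Sum.inl false

/-- All registers of the program are at most `N`. -/
def Prog.Bounded (N : ℕ) : Prog → Prop
  | .skip => True
  | .push r _ => r ≤ N
  | .seq p q => p.Bounded N ∧ q.Bounded N
  | .case r p => r ≤ N ∧ ∀ o, (p o).Bounded N
  | .loop r p => r ≤ N ∧ ∀ a, (p a).Bounded N
  | .call i o => i ≤ N ∧ o ≤ N

theorem Prog.Bounded.mono {N M : ℕ} (h : N ≤ M) : {p : Prog} → p.Bounded N → p.Bounded M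
  | .skip, _ => trivial
  | .push _ _, hp => le_trans (b := N) hp h
  | .seq _ _, hp => ⟨hp.1.mono h, hp.2.mono h⟩
  | .case _ _, hp => ⟨hp.1.trans h, fun o => (hp.2 o).mono h⟩
  | .loop _ _, hp => ⟨hp.1.trans h, fun a => (hp.2 a).mono h⟩
  | .call _ _, hp => ⟨hp.1.trans h, hp.2.trans h⟩

/-- A machine has finitely many stacks. A program uses finitely many registers because `case` and
`loop` branch over a finite alphabet. -/
theorem Prog.exists_bounded (p : Prog) : ∃ N, p.Bounded N := by
  induction p with
  | skip => exact ⟨0, trivial⟩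
  | push r a => exact ⟨r, le_refl r⟩
  | seq p q hp hq =>
    obtain ⟨N, hN⟩ := hp
    obtain ⟨M, hM⟩ := hq
    exact ⟨max N M, hN.mono (le_max_left _ _), hM.mono (le_max_right _ _)⟩
  | case r p hp =>
    choose N hN using hp
    exact ⟨max r (Finset.univ.sup N), le_max_left _ _, fun o => (hN o).mono
      ((Finset.le_sup (Finset.mem_univ o)).trans (le_max_right _ _))⟩
  | loop r p hp =>
    choose N hN using hp
    exact ⟨max r (Finset.univ.sup N), le_max_left _ _, fun o => (hN o).mono
      ((Finset.le_sup (Finset.mem_univ o)).trans (le_max_right _ _))⟩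
  | call i o => exact ⟨max i o, le_max_left _ _, le_max_right _ _⟩

variable (N : ℕ)

/-- The stacks of the compiled machine: those of the subroutine, an output stack and `N + 1`
registers. -/
abbrev StackIdx := C.tm.K ⊕ Option (Fin (N + 1))

/-- The alphabets of the stacks of the compiled machine. -/
abbrev StackSym : StackIdx C N → Type
  | .inl k => C.tm.Γ k
  | .inr none => Bool
  | .inr (some _) => Sym

/-- The internal states of the compiled machine: a state of the subroutine and the last symbol
that was popped. -/
abbrev MState := C.tm.σ × Option Sym

variable {C N} in
/-- The stack of a register. -/
abbrev regIdx (r : ℕ) : StackIdx C N := .inr (some (Fin.ofNat (N + 1) r))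

variable {C N} in
/-- A statement of the subroutine as a statement of the compiled machine, which jumps to `x`
instead of halting. -/
def liftStmt {L : Type} (e : C.tm.Λ → L) (x : L) :
    TM2.Stmt C.tm.Γ C.tm.Λ C.tm.σ → TM2.Stmt (StackSym C N) L (MState C)
  | .push k f q => .push (.inl k) (fun v => f v.1) (liftStmt e x q)
  | .peek k f q => .peek (.inl k) (fun v a => (f v.1 a, v.2)) (liftStmt e x q)
  | .pop k f q => .pop (.inl k) (fun v a => (f v.1 a, v.2)) (liftStmt e x q)
  | .load f q => .load (fun v => (f v.1, v.2)) (liftStmt e x q)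
  | .branch f q q' => .branch (fun v => f v.1) (liftStmt e x q) (liftStmt e x q')
  | .goto f => .goto fun v => e (f v.1)
  | .halt => .goto fun _ => x

variable {C N} in
/-- The machine code of a program, with labels embedded by `e` and with exit label `x`. -/
def Prog.compile {L : Type} :
    (p : Prog) → (p.Lab C → L) → L → p.Lab C → TM2.Stmt (StackSym C N) L (MState C)
  | .skip, _, x, _ => .goto fun _ => x
  | .push r a, _, x, _ => .push (regIdx r) (fun _ => a) (.goto fun _ => x)
  | .seq p q, e, x, l =>
    match (l : p.Lab C ⊕ q.Lab C) with
    | .inl l => p.compile (fun l => e (Sum.inl l)) (e (Sum.inr (q.entry C))) l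
    | .inr l => q.compile (fun l => e (Sum.inr l)) x l
  | .case r p, e, x, l =>
    match (l : Option (Σ o, (p o).Lab C)) with
    | none => .pop (regIdx r) (fun v a => (v.1, a))
        (.goto fun v => e (some ⟨v.2, (p v.2).entry C⟩ : Option _))
    | some ⟨o, l⟩ => (p o).compile (fun l => e (some ⟨o, l⟩ : Option _)) x l
  | .loop r p, e, x, l =>
    match (l : Option (Σ o, (p o).Lab C)) with
    | none => .pop (regIdx r) (fun v a => (v.1, a))
        (.goto fun v => v.2.elim x fun a => e (some ⟨a, (p a).entry C⟩ : Option _))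
    | some ⟨a, l⟩ => (p a).compile (fun l => e (some ⟨a, l⟩ : Option _)) (e (none : Option _)) l
  | .call i o, e, x, l =>
    match (l : Bool ⊕ C.tm.Λ) with
    | .inl false => .pop (regIdx i) (fun v a => (v.1, a))
        (.branch (fun v => v.2.isSome)
          (.push (.inl C.tm.k₀)
            (fun v => C.inputAlphabet.invFun ((v.2.getD none).getD false))
            (.goto fun _ => e (Sum.inl false)))
          (.goto fun _ => e (Sum.inr C.tm.main)))
    | .inl true => .pop (.inl C.tm.k₁) (fun v a => (v.1, a.map fun a => some (C.outputAlphabet a)))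
        (.branch (fun v => v.2.isSome)
          (.push (regIdx o) (fun v => v.2.getD none) (.goto fun _ => e (Sum.inl true)))
          (.goto fun _ => x))
    | .inr q => liftStmt (fun q => e (Sum.inr q)) (e (Sum.inl true)) (C.tm.m q)

end Compile

/-! ### Correctness of the compilation -/

/-- The configuration `c'` is reached from `c` in exactly `n` steps. -/
def ReachesIn {σ : Type*} (f : σ → Option σ) (n : ℕ) (c c' : σ) : Prop :=
  (flip bind f)^[n] (some c) = some c'

theorem ReachesIn.refl {σ : Type*} (f : σ → Option σ) (c : σ) : ReachesIn f 0 c c := rfl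

theorem ReachesIn.head {σ : Type*} {f : σ → Option σ} {n : ℕ} {c c' c'' : σ} (h : f c = some c')
    (h' : ReachesIn f n c' c'') : ReachesIn f (n + 1) c c'' := by
  unfold ReachesIn at *
  rw [iterate_succ_apply]
  have : flip bind f (some c) = some c' := h
  rw [this, h']

theorem ReachesIn.trans {σ : Type*} {f : σ → Option σ} {n m : ℕ} {c c' c'' : σ}
    (h : ReachesIn f n c c') (h' : ReachesIn f m c' c'') : ReachesIn f (n + m) c c'' := by
  unfold ReachesIn at *
  rw [Nat.add_comm, iterate_add_apply, h, h']

theorem ReachesIn.single {σ : Type*} {f : σ → Option σ} {c c' : σ} (h : f c = some c') :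
    ReachesIn f 1 c c' := (ReachesIn.refl f c').head h

/-- A simulation carries over runs that do not end prematurely. -/
theorem ReachesIn.map {σ τ : Type*} {f : σ → Option σ} {g : τ → Option τ} (tr : σ → τ)
    (h : ∀ c c', f c = some c' → g (tr c) = some (tr c')) {n : ℕ} {c c' : σ}
    (hr : ReachesIn f n c c') : ReachesIn g n (tr c) (tr c') := by
  induction n generalizing c with
  | zero => cases hr; rfl
  | succ n ih =>
    unfold ReachesIn at hr
    rw [iterate_succ_apply] at hr
    change (flip bind f)^[n] (f c) = some c' at hr
    cases hc : f c with
    | none =>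
      rw [hc] at hr
      have : ∀ n, (flip bind f)^[n] (none : Option σ) = none := fun n => by
        induction n with
        | zero => rfl
        | succ n ih => rw [iterate_succ_apply]; exact ih
      rw [this] at hr
      cases hr
    | some d =>
      rw [hc] at hr
      exact (ih hr).head (h _ _ hc)

section

variable {C : TM2ComputableAux Bool Bool} {N : ℕ}

/-- The stacks of the compiled machine for given stacks of the subroutine and given registers; the
output stack is empty. -/
def mkStacks (S : ∀ k, List (C.tm.Γ k)) (s : Store) : (k : StackIdx C N) → List (StackSym C N k)
  | .inl k => S k
  | .inr none => []
  | .inr (some i) => s i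

/-- `regIdx` reduces modulo `N + 1`; the bound on `r` excludes that two registers share a stack. -/
theorem mkStacks_reg (S : ∀ k, List (C.tm.Γ k)) (s : Store) {r : ℕ} (h : r ≤ N) :
    mkStacks S s (regIdx r : StackIdx C N) = s r := by
  change s _ = s r
  rw [Fin.val_ofNat, Nat.mod_eq_of_lt (Nat.lt_succ_of_le h)]

theorem update_mkStacks_reg (S : ∀ k, List (C.tm.Γ k)) (s : Store) {r : ℕ} (h : r ≤ N)
    (l : List Sym) :
    update (mkStacks S s) (regIdx r : StackIdx C N) l = mkStacks S (update s r l) := by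
  funext k
  rcases k with k | _ | i
  · rfl
  · rfl
  · have hr : (Fin.ofNat (N + 1) r).val = r := by
      rw [Fin.val_ofNat, Nat.mod_eq_of_lt (Nat.lt_succ_of_le h)]
    by_cases hi : i = Fin.ofNat (N + 1) r
    · subst hi
      change update (mkStacks S s) (regIdx r : StackIdx C N) l (regIdx r) = update s r l _
      rw [update_self, hr, update_self]
    · have : (Sum.inr (some i) : StackIdx C N) ≠ regIdx r :=
        fun h' => hi (Option.some.inj (Sum.inr.inj h'))
      rw [update_of_ne this]
      change s i = update s r l i
      rw [update_of_ne]
      intro h'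
      exact hi (Fin.ext (h'.trans hr.symm))

theorem update_mkStacks_inl (S : ∀ k, List (C.tm.Γ k)) (s : Store) (k : C.tm.K)
    (l : List (C.tm.Γ k)) :
    update (mkStacks S s) (.inl k : StackIdx C N) l = mkStacks (update S k l) s := by
  funext k'
  rcases k' with k' | _ | i
  · by_cases h : k' = k
    · subst h
      change update (mkStacks S s) (.inl k' : StackIdx C N) l (.inl k') = update S k' l k'
      rw [update_self, update_self]
    · have : (Sum.inl k' : StackIdx C N) ≠ .inl k := by simpa using h
      rw [update_of_ne this]
      change S k' = update S k l k'
      rw [update_of_ne h]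
  · rfl
  · rfl

/-- The configuration of the compiled machine for a given configuration of the subroutine. -/
def liftCfg {L : Type} (e : C.tm.Λ → L) (x : L) (v : Option Sym) (s : Store) (c : C.tm.Cfg) :
    TM2.Cfg (StackSym C N) L (MState C) :=
  ⟨some (c.l.elim x e), (c.var, v), mkStacks c.stk s⟩

/-- The subroutine's steps are simulated one for one; halting becomes a jump to `x`, and the
registers and the last popped symbol stay untouched. -/
theorem stepAux_liftStmt {L : Type} (e : C.tm.Λ → L) (x : L) (v : Option Sym) (s : Store)
    (q : TM2.Stmt C.tm.Γ C.tm.Λ C.tm.σ) (w : C.tm.σ) (S : ∀ k, List (C.tm.Γ k)) :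
    TM2.stepAux (liftStmt e x q) (w, v) (mkStacks S s : (k : StackIdx C N) → List (StackSym C N k)) =
      liftCfg e x v s (TM2.stepAux q w S) := by
  induction q generalizing w S with
  | push k f q ih =>
    simp only [liftStmt, TM2.stepAux]
    rw [← ih]
    congr 1
    exact update_mkStacks_inl _ _ _ _
  | peek k f q ih => exact ih _ _
  | pop k f q ih =>
    simp only [liftStmt, TM2.stepAux]
    rw [← ih]
    congr 1
    exact update_mkStacks_inl _ _ _ _
  | load f q ih => exact ih _ _
  | branch f q q' ih ih' =>
    simp only [liftStmt, TM2.stepAux]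
    cases f w
    · exact ih' _ _
    · exact ih _ _
  | goto f => rfl
  | halt => rfl

/-- A configuration in which the subroutine is idle. -/
def idleCfg {L : Type} (l : L) (v : Option Sym) (s : Store) :
    TM2.Cfg (StackSym C N) L (MState C) :=
  ⟨some l, (C.tm.initialState, v), mkStacks (fun _ => []) s⟩

theorem initList_stk (tm : FinTM2) (l : List (tm.Γ tm.k₀)) :
    (initList tm l).stk = update (fun _ => []) tm.k₀ l := by
  funext k
  by_cases h : k = tm.k₀
  · subst h
    simp [initList]
  · rw [update_of_ne h]
    simp [initList, h]

theorem haltList_stk (tm : FinTM2) (l : List (tm.Γ tm.k₁)) :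
    (haltList tm l).stk = update (fun _ => []) tm.k₁ l := by
  funext k
  by_cases h : k = tm.k₁
  · subst h
    simp [haltList]
  · rw [update_of_ne h]
    simp [haltList, h]

variable {L : Type} {M : L → TM2.Stmt (StackSym C N) L (MState C)}

/-- The part `T` of the input stack that is already loaded is kept general for the induction; the
call itself starts with `T` empty. -/
theorem reachesIn_call_load {i o : ℕ} {e : (Prog.call i o).Lab C → L} {x : L}
    (hM : ∀ l, M (e l) = Prog.compile (.call i o) e x l) (hi : i ≤ N) (v : Option Sym)
    (s : Store) (l : List Bool) (T : List (C.tm.Γ C.tm.k₀)) (hs : s i = l.map some) :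
    ReachesIn (TM2.step M) (l.length + 1)
      ⟨some (e (Sum.inl false)), (C.tm.initialState, v), mkStacks (update (fun _ => []) C.tm.k₀ T) s⟩
      ⟨some (e (Sum.inr C.tm.main)), (C.tm.initialState, none),
        mkStacks (update (fun _ => []) C.tm.k₀ (l.reverse.map C.inputAlphabet.invFun ++ T))
          (update s i [])⟩ := by
  induction l generalizing s T v with
  | nil =>
    apply ReachesIn.single
    have h0 : s i = [] := hs
    rw [TM2.step, hM]
    simp only [Prog.compile, TM2.stepAux, mkStacks_reg _ _ hi]
    rw [update_mkStacks_reg _ _ hi, h0]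
    rfl
  | cons b l ih =>
    have hs' : s i = some b :: l.map some := hs
    refine ReachesIn.head (c' := ⟨some (e (Sum.inl false)), (C.tm.initialState, some (some b)),
      mkStacks (update (fun _ => []) C.tm.k₀ (C.inputAlphabet.invFun b :: T))
        (update s i (l.map some))⟩) ?_ ?_
    · rw [TM2.step, hM]
      simp only [Prog.compile, TM2.stepAux, mkStacks_reg _ _ hi]
      rw [update_mkStacks_reg _ _ hi, hs']
      simp only [List.head?_cons, Option.isSome_some, cond_true, List.tail_cons]
      have hT : mkStacks (N := N) (update (fun _ => []) C.tm.k₀ T) (update s i (l.map some))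
          (Sum.inl C.tm.k₀) = T := by
        change update (fun _ => []) C.tm.k₀ T C.tm.k₀ = T
        rw [update_self]
      rw [update_mkStacks_inl, hT, update_idem]
      rfl
    · have := ih (some (some b)) (update s i (l.map some)) (C.inputAlphabet.invFun b :: T)
        (by rw [update_self])
      rw [update_idem] at this
      simpa using this

theorem reachesIn_call_unload {i o : ℕ} {e : (Prog.call i o).Lab C → L} {x : L}
    (hM : ∀ l, M (e l) = Prog.compile (.call i o) e x l) (ho : o ≤ N) (v : Option Sym)
    (s : Store) (l : List Bool) :
    ReachesIn (TM2.step M) (l.length + 1)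
      ⟨some (e (Sum.inl true)), (C.tm.initialState, v),
        mkStacks (update (fun _ => []) C.tm.k₁ (l.map C.outputAlphabet.invFun)) s⟩
      (idleCfg x none (update s o ((l.map some).reverse ++ s o))) := by
  induction l generalizing s v with
  | nil =>
    apply ReachesIn.single
    rw [TM2.step, hM]
    simp only [Prog.compile, TM2.stepAux, List.map_nil, List.reverse_nil, List.nil_append,
      update_eq_self]
    have : mkStacks (N := N) (fun _ => []) s (Sum.inl C.tm.k₁) = [] := rfl
    rw [this, update_mkStacks_inl]
    simp only [List.head?_nil, Option.map_none, Option.isSome_none, cond_false, List.tail_nil]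
    unfold idleCfg
    congr 3
    exact update_eq_self _ _
  | cons b l ih =>
    refine ReachesIn.head (c' := ⟨some (e (Sum.inl true)), (C.tm.initialState, some (some b)),
      mkStacks (update (fun _ => []) C.tm.k₁ (l.map C.outputAlphabet.invFun))
        (update s o (some b :: s o))⟩) ?_ ?_
    · rw [TM2.step, hM]
      simp only [Prog.compile, TM2.stepAux]
      have : mkStacks (N := N) (update (fun _ => []) C.tm.k₁
          ((b :: l).map C.outputAlphabet.invFun)) s (Sum.inl C.tm.k₁) =
          C.outputAlphabet.invFun b :: l.map C.outputAlphabet.invFun := by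
        change update (fun _ => []) C.tm.k₁ _ C.tm.k₁ = _
        rw [update_self]
        rfl
      rw [this, update_mkStacks_inl, update_idem]
      simp only [List.head?_cons, Option.map_some, Option.isSome_some, cond_true, List.tail_cons]
      rw [mkStacks_reg _ _ ho, update_mkStacks_reg _ _ ho]
      simp
    · have := ih (some (some b)) (update s o (some b :: s o))
      rw [update_self, update_idem] at this
      simpa using this

/-- Induction on the run. The hypothesis on `M` concerns only labels in the range of `e`, so it
passes to subprograms, whose labels are embedded by restrictions of `e`. The last popped symbol is
arbitrary at both ends, which lets runs be concatenated. -/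
theorem Runs.reachesIn {p : Prog} {s s' : Store} {t : ℕ} (h : Runs C p s t s')
    {e : p.Lab C → L} {x : L} (hM : ∀ l, M (e l) = p.compile e x l) (hp : p.Bounded N)
    (v : Option Sym) :
    ∃ v' n, n ≤ t ∧
      ReachesIn (TM2.step M) n (idleCfg (e (p.entry C)) v s) (idleCfg x v' s') := by
  induction h generalizing x v with
  | skip s =>
    refine ⟨v, 1, le_rfl, .single ?_⟩
    rw [idleCfg, TM2.step, hM]
    rfl
  | push r a s =>
    refine ⟨v, 1, le_rfl, .single ?_⟩
    rw [idleCfg, TM2.step, hM]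
    simp only [Prog.compile, TM2.stepAux]
    have hr : r ≤ N := hp
    rw [mkStacks_reg _ _ hr, update_mkStacks_reg _ _ hr]
    rfl
  | @seq p q s t s' t' s'' h h' ih ih' =>
    obtain ⟨v₁, n₁, hn₁, h₁⟩ := ih (e := fun l => e (Sum.inl l)) (x := e (Sum.inr (q.entry C)))
      (fun l => hM (Sum.inl l)) hp.1 v
    obtain ⟨v₂, n₂, hn₂, h₂⟩ := ih' (e := fun l => e (Sum.inr l)) (x := x)
      (fun l => hM (Sum.inr l)) hp.2 v₁
    exact ⟨v₂, n₁ + n₂, add_le_add hn₁ hn₂, h₁.trans h₂⟩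
  | @case r p s t s' h ih =>
    obtain ⟨v₁, n₁, hn₁, h₁⟩ := ih (e := fun l => e (some ⟨_, l⟩ : Option (Σ o, (p o).Lab C)))
      (x := x) (fun l => hM (some ⟨_, l⟩ : Option (Σ o, (p o).Lab C))) (hp.2 _) (s r).head?
    refine ⟨v₁, n₁ + 1, by omega, h₁.head ?_⟩
    rw [idleCfg, TM2.step, hM]
    simp only [Prog.entry, Prog.compile, TM2.stepAux]
    have hr : r ≤ N := hp.1
    rw [mkStacks_reg _ _ hr, update_mkStacks_reg _ _ hr]
    rfl
  | @loop_nil r p s h =>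
    refine ⟨none, 1, le_rfl, .single ?_⟩
    rw [idleCfg, TM2.step, hM]
    simp only [Prog.entry, Prog.compile, TM2.stepAux]
    have hr : r ≤ N := hp.1
    rw [mkStacks_reg _ _ hr, update_mkStacks_reg _ _ hr, h]
    have : update s r [] = s := by rw [← h, update_eq_self]
    simp [this, idleCfg]
  | @loop_cons r p s a l t s' t' s'' hs h h' ih ih' =>
    obtain ⟨v₁, n₁, hn₁, h₁⟩ := ih (e := fun l => e (some ⟨a, l⟩ : Option (Σ o, (p o).Lab C)))
      (x := e (none : Option _)) (fun l => hM (some ⟨a, l⟩ : Option (Σ o, (p o).Lab C)))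
      (hp.2 _) (some a)
    obtain ⟨v₂, n₂, hn₂, h₂⟩ := ih' hM hp v₁
    refine ⟨v₂, n₁ + n₂ + 1, by omega, (h₁.trans h₂).head ?_⟩
    rw [idleCfg, TM2.step, hM]
    simp only [Prog.entry, Prog.compile, TM2.stepAux]
    have hr : r ≤ N := hp.1
    rw [mkStacks_reg _ _ hr, update_mkStacks_reg _ _ hr, hs]
    rfl
  | @call i o s t l l' hs h =>
    obtain ⟨h⟩ := h
    have h₁ := reachesIn_call_load hM hp.1 v s l.reverse [] (by rw [hs, List.map_reverse])
    have h₂ : ReachesIn C.tm.step h.steps (initList C.tm (l.map C.inputAlphabet.invFun))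
      (haltList C.tm (l'.map C.outputAlphabet.invFun)) := h.evals_in_steps
    have h₂' := h₂.map (g := TM2.step M) (liftCfg (fun q => e (Sum.inr q)) (e (Sum.inl true)) none
      -- A halted configuration has no successor, so the simulation has to be checked at running
      -- labels only.
      (update s i [])) (by
        rintro ⟨_ | q, w, S⟩ c' hc
        · cases hc
        · cases hc
          unfold liftCfg
          rw [TM2.step]
          dsimp only [Option.elim]
          rw [hM]
          congr 1
          exact stepAux_liftStmt _ _ _ _ _ _ _)
    have h₃ := reachesIn_call_unload hM hp.2 none (update s i []) l'
    refine ⟨none, l.length + 1 + h.steps + (l'.length + 1), by have := h.steps_le_m; omega, ?_⟩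
    rw [List.length_reverse, List.reverse_reverse, List.append_nil] at h₁
    unfold liftCfg at h₂'
    rw [initList_stk, haltList_stk] at h₂'
    rw [update_eq_self] at h₁
    exact (h₁.trans h₂').trans h₃

end

/-! ### Decision procedures given by programs -/

/-- The stack machine that runs the program `p` on its input in register `0` and outputs whether
register `3` is nonempty. -/
noncomputable def machine (C : TM2ComputableAux Bool Bool) (N : ℕ) (p : Prog) : FinTM2 where
  K := StackIdx C N
  kDecidableEq := letI := C.tm.kDecidableEq; inferInstance
  kFin := letI := C.tm.kFin; inferInstance
  k₀ := .inr (some 0)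
  k₁ := .inr none
  Γ := StackSym C N
  Λ := Option (p.Lab C)
  main := some (p.entry C)
  ΛFin := letI := p.finite_lab C; Fintype.ofFinite _
  σ := MState C
  initialState := (C.tm.initialState, none)
  σFin := letI := C.tm.σFin; inferInstance
  Γk₀Fin := inferInstanceAs (Fintype Sym)
  m
    | some l => p.compile some none l
    | none => .pop (regIdx 3) (fun v a => (v.1, a)) (.push (.inr none) (fun v => v.2.isSome)
        (.load (fun _ => (C.tm.initialState, none)) .halt))

theorem initList_machine {C : TM2ComputableAux Bool Bool} {N : ℕ} {p : Prog} (l : List Sym) :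
    initList (machine C N p) l =
      idleCfg (some (p.entry C)) none (update (fun _ => []) 0 l) := by
  have : (initList (machine C N p) l).stk = mkStacks (fun _ => []) (update (fun _ => []) 0 l) := by
    refine (initList_stk (machine C N p) l).trans ?_
    change update (fun k : StackIdx C N => ([] : List (StackSym C N k))) (regIdx 0) l = _
    rw [← update_mkStacks_reg _ _ (Nat.zero_le N)]
    congr 1
    funext k
    rcases k with k | _ | i <;> rfl
  exact congrArg (fun S => (⟨some (some (p.entry C)), (C.tm.initialState, none), S⟩ :
    TM2.Cfg (StackSym C N) (Option (p.Lab C)) (MState C))) this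

theorem haltList_machine {C : TM2ComputableAux Bool Bool} {N : ℕ} {p : Prog} (l : List Bool) :
    haltList (machine C N p) l =
      ⟨none, (C.tm.initialState, none),
        update (mkStacks (N := N) (fun _ => []) (fun _ => [])) (.inr none) l⟩ := by
  have : (haltList (machine C N p) l).stk =
      update (mkStacks (N := N) (fun _ => []) (fun _ => [])) (.inr none) l := by
    refine (haltList_stk (machine C N p) l).trans ?_
    change update (fun k : StackIdx C N => ([] : List (StackSym C N k))) (Sum.inr none) l = _
    congr 1
    funext k
    rcases k with k | _ | i <;> rfl
  exact congrArg (fun S => (⟨none, (C.tm.initialState, none), S⟩ :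
    TM2.Cfg (StackSym C N) (Option (p.Lab C)) (MState C))) this

/-- A program that decides a predicate in polynomial time yields a polynomial time machine. -/
theorem nonempty_computable_of_runs (C : TM2ComputableAux Bool Bool) {α : Type}
    {ea : α → List Sym} {f : α → Bool} (p : Prog) (q : Polynomial ℕ)
    (h : ∀ a, ∃ t ≤ q.eval (ea a).length, Runs C p (update (fun _ => []) 0 (ea a)) t
      (update (fun _ => []) 3 (if f a then [some true] else []))) :
    Nonempty (TM2ComputableInPolyTime ea Computability.encodeBool f) := by
  obtain ⟨N, hN⟩ := p.exists_bounded
  -- Register `3` carries the answer and must exist even if the program never uses it.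
  replace hN := hN.mono (le_max_left N 3)
  generalize max N 3 = N', le_max_right N 3 = h3 at hN
  refine ⟨⟨⟨machine C N' p, Equiv.refl _, Equiv.refl _⟩, q + 1, fun a => ?_⟩⟩
  apply Classical.choice
  obtain ⟨t, ht, hr⟩ := h a
  obtain ⟨v, n, hn, hrun⟩ := hr.reachesIn (M := (machine C N' p).m) (e := some) (x := none)
    (fun _ => rfl) hN none
  -- `haltList` requires the initial internal state and empty stacks apart from the output; hence
  -- the last statement pops the answer and resets the state.
  have hlast : ReachesIn (machine C N' p).step 1
      (idleCfg none v (update (fun _ => []) 3 (if f a then [some true] else [])))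
      (haltList (machine C N' p) (Computability.encodeBool (f a))) := by
    rw [haltList_machine]
    apply ReachesIn.single
    change some (TM2.stepAux (TM2.Stmt.pop (Γ := StackSym C N') (Λ := Option (p.Lab C)) (regIdx 3) (fun v a => (v.1, a))
      (.push (.inr none) (fun v => v.2.isSome)
        (.load (fun _ => (C.tm.initialState, none)) .halt))) _ _) = _
    simp only [TM2.stepAux]
    rw [mkStacks_reg _ _ h3, update_mkStacks_reg _ _ h3, update_idem, update_self]
    cases f a
    · simp
      rfl
    · simp
      rfl
  have hfull := hrun.trans hlast
  refine ⟨⟨⟨n + 1, ?_⟩, ?_⟩⟩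
  · have hin : initList (machine C N' p) (List.map (id : Sym → Sym) (ea a)) = _ :=
      (congrArg (fun l : List Sym => initList (machine C N' p) l) (List.map_id (ea a))).trans
        (initList_machine (ea a))
    have hout : haltList (machine C N' p) (List.map (id : Bool → Bool) (Computability.encodeBool (f a))) = _ :=
      congrArg (fun l : List Bool => haltList (machine C N' p) l) (List.map_id _)
    exact ((congrArg (fun c => (flip bind (machine C N' p).step)^[n + 1] (some c)) hin).trans
      hfull).trans (congrArg some hout.symm)
  · change n + 1 ≤ _
    rw [Polynomial.eval_add, Polynomial.eval_one]
    omega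

/-! ### Time bounds for programs -/

/-- Coefficients in `ℕ` make every polynomial monotone, so size estimates can be inserted into time
bounds. -/
theorem eval_le_eval (p : Polynomial ℕ) {m n : ℕ} (h : m ≤ n) : p.eval m ≤ p.eval n := by
  rw [Polynomial.eval_eq_sum_range, Polynomial.eval_eq_sum_range]
  gcongr

/-- The program `p` leads from `s` to `s'` within time `T`. -/
def RunsIn (C : TM2ComputableAux Bool Bool) (p : Prog) (s : Store) (T : ℕ) (s' : Store) : Prop :=
  ∃ t ≤ T, Runs C p s t s'

variable {C : TM2ComputableAux Bool Bool}

theorem RunsIn.mono {p : Prog} {s s' : Store} {T T' : ℕ} (h : RunsIn C p s T s') (hT : T ≤ T') :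
    RunsIn C p s T' s' :=
  let ⟨t, ht, hr⟩ := h
  ⟨t, ht.trans hT, hr⟩

theorem RunsIn.congr {p : Prog} {s s' s'' : Store} {T T' : ℕ} (h : RunsIn C p s T s')
    (hT : T ≤ T') (hs : s' = s'') : RunsIn C p s T' s'' := hs ▸ h.mono hT

theorem RunsIn.skip (s : Store) : RunsIn C .skip s 1 s := ⟨1, le_rfl, .skip s⟩

theorem RunsIn.push (r : ℕ) (a : Sym) (s : Store) :
    RunsIn C (.push r a) s 1 (update s r (a :: s r)) := ⟨1, le_rfl, .push r a s⟩

theorem RunsIn.seq {p q : Prog} {s s' s'' : Store} {T T' : ℕ} (h : RunsIn C p s T s')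
    (h' : RunsIn C q s' T' s'') : RunsIn C (.seq p q) s (T + T') s'' :=
  let ⟨t, ht, hr⟩ := h
  let ⟨t', ht', hr'⟩ := h'
  ⟨t + t', add_le_add ht ht', .seq hr hr'⟩

theorem RunsIn.case {r : ℕ} {p : Option Sym → Prog} {s s' : Store} {T : ℕ}
    (h : RunsIn C (p (s r).head?) (update s r (s r).tail) T s') :
    RunsIn C (.case r p) s (T + 1) s' :=
  let ⟨t, ht, hr⟩ := h
  ⟨t + 1, add_le_add_left ht 1, .case hr⟩

theorem RunsIn.loop_nil {r : ℕ} {p : Sym → Prog} {s : Store} (h : s r = []) :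
    RunsIn C (.loop r p) s 1 s := ⟨1, le_rfl, .loop_nil h⟩

theorem RunsIn.loop_cons {r : ℕ} {p : Sym → Prog} {s s' s'' : Store} {a : Sym} {l : List Sym}
    {T T' : ℕ} (hs : s r = a :: l) (h : RunsIn C (p a) (update s r l) T s')
    (h' : RunsIn C (.loop r p) s' T' s'') : RunsIn C (.loop r p) s (T + 1 + T') s'' :=
  let ⟨t, ht, hr⟩ := h
  let ⟨t', ht', hr'⟩ := h'
  ⟨t + 1 + t', by omega, .loop_cons hs hr hr'⟩

/-- The rule for loops: `f k` is the store after `k` rounds. -/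
theorem RunsIn.loop {r : ℕ} {p : Sym → Prog} {T : ℕ} (l : List Sym) (f : ℕ → Store)
    (hf : ∀ k, f k r = l.drop k)
    (h : ∀ k (hk : k < l.length), RunsIn C (p l[k]) (update (f k) r (l.drop (k + 1))) T (f (k + 1))) :
    RunsIn C (.loop r p) (f 0) (l.length * (T + 1) + 1) (f l.length) := by
  induction l generalizing f with
  | nil => exact (RunsIn.loop_nil (hf 0)).mono (by simp)
  | cons a l ih =>
    have h1 := ih (fun k => f (k + 1)) (fun k => by rw [hf]; rfl)
      (fun k hk => h (k + 1) (by simpa using hk))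
    refine (RunsIn.loop_cons (hf 0) (h 0 (by simp)) h1).mono ?_
    simp only [List.length_cons]
    ring_nf
    omega

/-- Moves the content of one register to another, in reverse order. -/
def Prog.move (r r' : ℕ) : Prog := .loop r fun a => .push r' a

/-- Empties a register. -/
def Prog.clear (r : ℕ) : Prog := .loop r fun _ => .skip

/-- Adds the length of register `r` to the unary number in `d`, with the help of register `e`. -/
def Prog.addLength (r d e : ℕ) : Prog :=
  .seq (.move r e) (.loop e fun a => .seq (.push r a) (.push d (some true)))

/-- A number in unary. -/
def unary (n : ℕ) : List Sym := List.replicate n (some true)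

@[simp] theorem length_unary (n : ℕ) : (unary n).length = n := List.length_replicate

@[simp] theorem unary_zero : unary 0 = [] := rfl

theorem unary_succ (n : ℕ) : unary (n + 1) = some true :: unary n := rfl

@[simp] theorem reverse_unary (n : ℕ) : (unary n).reverse = unary n := List.reverse_replicate

theorem drop_unary (n k : ℕ) : (unary n).drop k = unary (n - k) := List.drop_replicate

theorem RunsIn.move {r r' : ℕ} (h : r ≠ r') (s : Store) :
    RunsIn C (.move r r') s (2 * (s r).length + 1)
      (update (update s r []) r' ((s r).reverse ++ s r')) := by
  generalize hl : s r = l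
  induction l generalizing s with
  | nil =>
    have : update (update s r []) r' (([] : List Sym).reverse ++ s r') = s := by
      funext x
      simp only [update_apply]
      grind
    rw [this]
    exact (RunsIn.loop_nil hl).mono (by simp)
  | cons a l ih =>
    have h1 := ih (update (update s r l) r' (a :: update s r l r')) (by
      rw [update_of_ne h, update_self])
    have h2 := RunsIn.loop_cons (p := fun a => .push r' a) hl (RunsIn.push r' a _) h1
    refine h2.congr (by simp; omega) ?_
    funext x
    simp only [update_apply]
    grind

theorem RunsIn.clear (r : ℕ) (s : Store) :
    RunsIn C (.clear r) s (2 * (s r).length + 1) (update s r []) := by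
  generalize hl : s r = l
  induction l generalizing s with
  | nil =>
    rw [← hl, update_eq_self, hl]
    exact (RunsIn.loop_nil hl).mono (by simp)
  | cons a l ih =>
    have h1 := ih (update s r l) (update_self _ _ _)
    rw [update_idem] at h1
    exact (RunsIn.loop_cons (p := fun a => .skip) hl (RunsIn.skip _) h1).mono (by simp; omega)

/-- Register `r` is emptied into `e` and refilled from it; the two reversals cancel, so the source
survives the copy. -/
theorem RunsIn.addLength {r d e : ℕ} (hrd : r ≠ d) (hre : r ≠ e) (hde : d ≠ e) (s : Store)
    (he : s e = []) :
    RunsIn C (.addLength r d e) s (5 * (s r).length + 2)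
      (update s d (unary (s r).length ++ s d)) := by
  have h2 : ∀ (l : List Sym) (s : Store), s e = l → RunsIn C
      (.loop e fun a => .seq (.push r a) (.push d (some true))) s (3 * l.length + 1)
      (update (update (update s e []) d (unary l.length ++ s d)) r (l.reverse ++ s r)) := by
    intro l
    induction l with
    | nil =>
      intro s hs
      have : update (update (update s e []) d (unary ([] : List Sym).length ++ s d)) r
          (([] : List Sym).reverse ++ s r) = s := by
        funext x
        simp only [update_apply, List.length_nil, unary_zero]
        grind
      rw [this]
      exact (RunsIn.loop_nil hs).mono (by simp)
    | cons a l ih =>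
      intro s hs
      have h1 := RunsIn.loop_cons (p := fun a => .seq (.push r a) (.push d (some true))) hs
        ((RunsIn.push r a _).seq (RunsIn.push d (some true) _)) (ih _ (by
          simp [update_apply, hre.symm, hde.symm]))
      refine h1.congr (by simp; omega) ?_
      have hu : ∀ t : List Sym, unary l.length ++ some true :: t =
          unary (l.length + 1) ++ t := by
        intro t
        rw [unary, unary, List.replicate_succ']
        simp
      funext x
      simp only [update_apply]
      grind
  have h3 := (RunsIn.move hre s).seq (h2 (s r).reverse _ (by simp [he]))
  refine h3.congr (by simp; omega) ?_
  funext x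
  simp only [update_apply]
  grind

/-! ### Polynomial time functions of words and unary numbers -/

/-- Environments that consist of three words and some numbers. -/
class Env (α : Type) where
  /-- The numbers. -/
  vars : List (α → ℕ)
  /-- The words. -/
  word : α → Fin 3 → List Bool

instance : Env (Fin 3 → List Bool) := ⟨[], id⟩

instance {α : Type} [Env α] : Env (α × ℕ) :=
  ⟨Prod.snd :: Env.vars.map fun v p => v p.1, fun p => Env.word p.1⟩

section

variable {α : Type} [Env α]

/-- The size of an environment. -/
def Env.size (a : α) : ℕ := ∑ i, (Env.word a i).length + (Env.vars.map fun v => v a).sum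

theorem Env.size_prod (p : α × ℕ) : Env.size p = Env.size p.1 + p.2 := by
  simp only [Env.size, Env.word, Env.vars, List.map_cons, List.map_map, List.sum_cons]
  rw [add_assoc, add_comm p.2]
  rfl

theorem Env.length_word_le (a : α) (i : Fin 3) : (Env.word a i).length ≤ Env.size a :=
  (Finset.single_le_sum (f := fun i => (Env.word a i).length) (fun _ _ => Nat.zero_le _)
    (Finset.mem_univ i)).trans (Nat.le_add_right _ _)

/-- The store holds the words in the registers `0`, `1` and `2`, and the numbers in `regs`; the
registers from `d` on are free. -/
structure Holds (a : α) (regs : List ℕ) (d : ℕ) (s : Store) : Prop where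
  word : ∀ i : Fin 3, s i = (Env.word a i).map some
  vars : List.Forall₂ (fun v r => s r = unary (v a)) Env.vars regs
  free : ∀ r ≥ d, s r = []

/-- Moves the border of the free registers: results written from `d` on do not disturb the
environment stored below `d`. -/
theorem Holds.congr {a : α} {regs : List ℕ} {d d' : ℕ} {s s' : Store} (h : Holds a regs d s)
    (hd : 3 ≤ d) (hr : ∀ r ∈ regs, r < d) (hs : ∀ r < d, s' r = s r) (hf : ∀ r ≥ d', s' r = []) :
    Holds a regs d' s' where
  word i := by rw [hs _ (by omega), h.word]
  vars := by
    have := h.vars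
    rw [List.forall₂_iff_get] at this ⊢
    refine ⟨this.1, fun i h₁ h₂ => ?_⟩
    rw [hs _ (hr _ (List.get_mem _ _)), this.2 i h₁ h₂]
  free := hf

theorem Holds.cons {a : α} {regs : List ℕ} {d : ℕ} {s : Store} (h : Holds a regs d s) {n r : ℕ}
    (hr : s r = unary n) : Holds (a, n) (r :: regs) d s where
  word := h.word
  vars := .cons hr (List.forall₂_map_left_iff.2 h.vars)
  free := h.free

theorem Holds.tail {a : α × ℕ} {r : ℕ} {regs : List ℕ} {d : ℕ} {s : Store}
    (h : Holds a (r :: regs) d s) : Holds a.1 regs d s where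
  word := h.word
  vars := by
    have := h.vars
    simp only [Env.vars] at this
    cases this with
    | cons h1 h2 => exact List.forall₂_map_left_iff.1 h2
  free := h.free

end

/-- The number `f a`, in unary, can be computed from the environment `a` in polynomial time. -/
def PT (C : TM2ComputableAux Bool Bool) {α : Type} [Env α] (f : α → ℕ) : Prop :=
  -- The bounds are chosen before the register layout, so one function can be used in many layouts.
  -- The bound on the value is needed because values become loop counts and parts of larger
  -- environments.
  ∃ b q : Polynomial ℕ, (∀ a, f a ≤ b.eval (Env.size a)) ∧
    ∀ (regs : List ℕ) (d : ℕ), 3 ≤ d → (∀ r ∈ regs, r < d) → ∃ p : Prog, ∀ a s,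
      Holds a regs d s → RunsIn C p s (q.eval (Env.size a)) (update s d (unary (f a)))

/-! ### Basic functions and bounded recursion -/

namespace PT

variable {C : TM2ComputableAux Bool Bool} {α : Type} [Env α]

theorem zero : PT C fun _ : α => 0 := by
  refine ⟨0, 1, by simp, fun regs d _ _ => ⟨.skip, fun a s h => (RunsIn.skip s).congr (by simp) ?_⟩⟩
  rw [unary_zero, ← h.free d le_rfl, update_eq_self]

theorem succ {f : α → ℕ} (hf : PT C f) : PT C fun a => f a + 1 := by
  obtain ⟨b, q, hb, hp⟩ := hf
  refine ⟨b + 1, q + 1, fun a => by simpa using hb a, fun regs d hd hr => ?_⟩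
  obtain ⟨p, hp⟩ := hp regs d hd hr
  refine ⟨.seq p (.push d (some true)), fun a s h =>
    ((hp a s h).seq (RunsIn.push _ _ _)).congr (by simp) ?_⟩
  rw [update_self, update_idem, unary_succ]

theorem snd : PT C fun p : α × ℕ => p.2 := by
  refine ⟨.X, 5 * .X + 2, fun a => by simp [Env.size_prod], fun regs d hd hr => ?_⟩
  cases regs with
  | nil =>
    -- Vacuous: an environment with a number cannot be held when no register is assigned to it.
    refine ⟨.skip, fun a s h => ?_⟩
    have := h.vars
    simp [Env.vars] at this
  | cons r regs =>
    refine ⟨.addLength r d (d + 1), fun a s h => ?_⟩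
    have hrd : r < d := hr r (by simp)
    have hv : s r = unary a.2 := by
      have := h.vars
      simp only [Env.vars] at this
      cases this with
      | cons h1 h2 => exact h1
    refine (RunsIn.addLength (by omega) (by omega) (by omega) s (h.free _ (by omega))).congr ?_ ?_
    · simp [hv, Env.size_prod]
    · rw [h.free d le_rfl, hv]
      simp

theorem fst {f : α → ℕ} (hf : PT C f) : PT C fun p : α × ℕ => f p.1 := by
  obtain ⟨b, q, hb, hp⟩ := hf
  refine ⟨b, q, fun a => (hb a.1).trans (eval_le_eval _ (by simp [Env.size_prod])),
    fun regs d hd hr => ?_⟩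
  cases regs with
  | nil =>
    refine ⟨.skip, fun a s h => ?_⟩
    have := h.vars
    simp [Env.vars] at this
  | cons r regs =>
    obtain ⟨p, hp⟩ := hp regs d hd fun r' hr' => hr r' (by simp [hr'])
    exact ⟨p, fun a s h => (hp a.1 s h.tail).mono (eval_le_eval _ (by simp [Env.size_prod]))⟩

theorem length (i : Fin 3) : PT C fun a : α => (Env.word a i).length := by
  refine ⟨.X, 5 * .X + 2, fun a => by simpa using Env.length_word_le a i, fun regs d hd hr => ?_⟩
  refine ⟨.addLength i d (d + 1), fun a s h => ?_⟩
  refine (RunsIn.addLength (by omega) (by omega) (by omega) s (h.free _ (by omega))).congr ?_ ?_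
  · simpa [h.word] using Env.length_word_le a i
  · rw [h.free d le_rfl, h.word]
    simp

/-- Bounded recursion. -/
theorem natRec {n f : α → ℕ} {g : (α × ℕ) × ℕ → ℕ} (b : Polynomial ℕ) (hn : PT C n) (hf : PT C f)
    (hg : PT C g)
    (hb : ∀ a, ∀ k ≤ n a, Nat.rec (f a) (fun i acc => g ((a, i), acc)) k ≤ b.eval (Env.size a)) :
    PT C fun a => Nat.rec (f a) (fun i acc => g ((a, i), acc)) (n a) := by
  obtain ⟨bn, qn, hbn, hn⟩ := hn
  obtain ⟨bf, qf, hbf, hf⟩ := hf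
  obtain ⟨bg, qg, hbg, hg⟩ := hg
  -- Each of at most `bn` rounds evaluates `g`, clears the old accumulator, moves the new one into
  -- place and increases the index; the final summand clears the index.
  refine ⟨b, qf + (qn + ((bn * (qg.comp (.X + bn + b) + ((2 * b + 1) + ((2 * b + 1) + 1)) + 1) + 1) +
    (2 * bn + 1))), fun a => hb a _ le_rfl, fun regs d hd hr => ?_⟩
  obtain ⟨pf, hf⟩ := hf regs d hd hr
  obtain ⟨pn, hn⟩ := hn regs (d + 1) (by omega) fun r h => (hr r h).trans (by omega)
  -- Register `d` holds the accumulator, `d + 1` the number of rounds left, `d + 2` the index; the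
  -- value of `g` appears in `d + 3` and is then moved to `d`, where reversal does not matter in
  -- unary.
  obtain ⟨pg, hg⟩ := hg (d :: (d + 2) :: regs) (d + 3) (by omega) (by
    simp only [List.mem_cons]
    rintro r (rfl | rfl | h)
    · omega
    · omega
    · have := hr r h
      omega)
  refine ⟨.seq pf (.seq pn (.seq (.loop (d + 1) fun _ => .seq pg (.seq (.clear d)
    (.seq (.move (d + 3) d) (.push (d + 2) (some true))))) (.clear (d + 2)))), fun a s h => ?_⟩
  have r1 := hf a s h
  have r2 := hn a (update s d (unary (f a))) (h.congr hd hr (fun r hr => by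
    rw [update_of_ne (by omega)]) (fun r hr => by
    rw [update_of_ne (by omega), h.free _ (by omega)]))
  set v : ℕ → ℕ := fun k => Nat.rec (f a) (fun i acc => g ((a, i), acc)) k with hv
  set S : ℕ → Store := fun k =>
    update (update (update s d (unary (v k))) (d + 1) (unary (n a - k))) (d + 2) (unary k) with hS
  have hS0 : S 0 = update (update s d (unary (f a))) (d + 1) (unary (n a)) := by
    funext x
    have hv0 : v 0 = f a := rfl
    have := h.free (d + 2) (by omega)
    simp only [hS, hv0, update_apply, unary_zero, Nat.sub_zero]
    clear_value v
    grind
  have r3 : RunsIn C (.loop (d + 1) fun _ => .seq pg (.seq (.clear d)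
      (.seq (.move (d + 3) d) (.push (d + 2) (some true))))) (S 0)
      ((unary (n a)).length * ((qg.comp (.X + bn + b)).eval (Env.size a) +
        ((2 * b.eval (Env.size a) + 1) + ((2 * b.eval (Env.size a) + 1) + 1)) + 1) + 1)
      (S (unary (n a)).length) := by
    apply RunsIn.loop
    · intro k
      simp [hS, drop_unary]
    intro k hk
    rw [length_unary] at hk
    have h1 := hg ((a, k), v k) (update (S k) (d + 1) ((unary (n a)).drop (k + 1))) (by
      refine Holds.cons (Holds.cons (h.congr hd hr ?_ ?_) ?_) ?_
      · intro r hr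
        simp only [hS, update_apply]
        grind
      · intro r hr
        have := h.free r (by omega)
        simp only [hS, update_apply]
        grind
      · simp [hS]
      · simp [hS])
    have h2 := (h1.seq ((RunsIn.clear d _).seq ((RunsIn.move (r := d + 3) (r' := d) (by omega) _).seq
      (RunsIn.push (d + 2) (some true) _))))
    have hvk : v k ≤ b.eval (Env.size a) := hb a k hk.le
    have hvk1 : g ((a, k), v k) ≤ b.eval (Env.size a) := hb a (k + 1) hk
    refine h2.congr ?_ ?_
    -- The environment of `g` exceeds that of `f` by an index of at most `bn` and an accumulator of
    -- at most `b`.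
    · have e1 : qg.eval (Env.size ((a, k), v k)) ≤ (qg.comp (.X + bn + b)).eval (Env.size a) := by
        rw [Polynomial.eval_comp]
        apply eval_le_eval
        simp only [Env.size_prod, Polynomial.eval_add, Polynomial.eval_X]
        have := hbn a
        omega
      gcongr
      · simpa [hS, update_apply] using hvk
      · simpa [hS, update_apply] using hvk1
    · funext x
      have := h.free (d + 3) (by omega)
      have hsucc : v (k + 1) = g ((a, k), v k) := rfl
      simp only [hS, update_apply, drop_unary]
      simp only [unary_succ, hsucc]
      by_cases x1 : x = d
      · subst x1; simp
      by_cases x2 : x = d + 1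
      · subst x2; simp
      by_cases x3 : x = d + 2
      · subst x3; simp
      by_cases x4 : x = d + 3
      · subst x4; simp [this]
      simp [x1, x2, x3, x4]
  rw [hS0] at r3
  refine (r1.seq (r2.seq (r3.seq (RunsIn.clear (d + 2) _)))).congr ?_ ?_
  · simp only [length_unary, Polynomial.eval_add, Polynomial.eval_mul, Polynomial.eval_one,
      Polynomial.eval_ofNat]
    have h1 : (unary (n a)).length = n a := length_unary _
    have h2 : (S (n a) (d + 2)).length ≤ bn.eval (Env.size a) := by
      simpa [hS, update_apply] using hbn a
    have h3 := hbn a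
    have h4 : qn.eval (Env.size a) = qn.eval (Env.size a) := rfl
    gcongr
  · rw [length_unary]
    funext x
    have := h.free (d + 1) (by omega)
    have := h.free (d + 2) (by omega)
    simp only [hS, update_apply, Nat.sub_self, unary_zero]
    change _ = if x = d then unary (v (n a)) else s x
    grind

end PT

/-- The truth value of a proposition as a number. -/
noncomputable def ind (P : Prop) : ℕ := open Classical in if P then 1 else 0

theorem ind_true {P : Prop} (h : P) : ind P = 1 := if_pos h

theorem ind_false {P : Prop} (h : ¬P) : ind P = 0 := if_neg h

theorem ind_le_one (P : Prop) : ind P ≤ 1 := by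
  by_cases h : P
  · rw [ind_true h]
  · rw [ind_false h]
    exact Nat.zero_le 1

/-- The predicate `P` of environments can be decided in polynomial time. -/
def PTP (C : TM2ComputableAux Bool Bool) {α : Type} [Env α] (P : α → Prop) : Prop :=
  PT C fun a => ind (P a)

variable {C : TM2ComputableAux Bool Bool} {α : Type} [Env α]

/-! ### Arithmetic, conditionals and bounded sums -/

namespace PT

theorem of_eq {f g : α → ℕ} (hf : PT C f) (h : ∀ a, f a = g a) : PT C g :=
  (funext h : f = g) ▸ hf

theorem exists_le {f : α → ℕ} (hf : PT C f) : ∃ b : Polynomial ℕ, ∀ a, f a ≤ b.eval (Env.size a) :=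
  let ⟨b, _, hb, _⟩ := hf
  ⟨b, hb⟩

/-- Bounded recursion, with the value of the recursion given explicitly. -/
theorem recOn {n : α → ℕ} {v : α → ℕ → ℕ} {g : α → ℕ → ℕ → ℕ} (b : Polynomial ℕ) (hn : PT C n)
    (h0 : PT C fun a => v a 0) (hg : PT C fun p : (α × ℕ) × ℕ => g p.1.1 p.1.2 p.2)
    (hv : ∀ a k, k < n a → v a (k + 1) = g a k (v a k))
    (hb : ∀ a, ∀ k ≤ n a, v a k ≤ b.eval (Env.size a)) : PT C fun a => v a (n a) := by
  have key : ∀ a, ∀ k ≤ n a, Nat.rec (v a 0) (fun i acc => g a i acc) k = v a k := by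
    intro a k
    induction k with
    | zero => intro _; rfl
    | succ k ih => intro hk; rw [hv a k hk, ← ih (by omega)]
  refine (natRec (g := fun p => g p.1.1 p.1.2 p.2) b hn h0 hg fun a k hk => ?_).of_eq
    fun a => key a _ le_rfl
  exact (key a k hk).le.trans (hb a k hk)

theorem const (n : ℕ) : PT C fun _ : α => n := by
  induction n with
  | zero => exact zero
  | succ n ih => exact ih.succ

theorem add {f g : α → ℕ} (hf : PT C f) (hg : PT C g) : PT C fun a => f a + g a := by
  obtain ⟨bf, hbf⟩ := hf.exists_le
  obtain ⟨bg, hbg⟩ := hg.exists_le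
  refine recOn (v := fun a k => f a + k) (g := fun _ _ acc => acc + 1) (bf + bg) hg hf snd.succ
    (fun _ _ _ => rfl) fun a k hk => ?_
  rw [Polynomial.eval_add]
  exact add_le_add (hbf a) (hk.trans (hbg a))

/-- The recursion ignores its accumulator and returns the index of the current round, so it ends
with the last index. -/
theorem pred {f : α → ℕ} (hf : PT C f) : PT C fun a => f a - 1 := by
  obtain ⟨bf, hbf⟩ := hf.exists_le
  refine recOn (v := fun a k => k - 1) (g := fun _ i _ => i) bf hf zero snd.fst
    (fun _ _ _ => rfl) fun a k hk => ?_
  exact (Nat.sub_le k 1).trans (hk.trans (hbf a))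

theorem sub {f g : α → ℕ} (hf : PT C f) (hg : PT C g) : PT C fun a => f a - g a := by
  obtain ⟨bf, hbf⟩ := hf.exists_le
  refine recOn (v := fun a k => f a - k) (g := fun _ _ acc => acc - 1) bf hg hf snd.pred
    (fun _ _ _ => rfl) fun a k hk => ?_
  exact (Nat.sub_le _ k).trans (hbf a)

theorem mul {f g : α → ℕ} (hf : PT C f) (hg : PT C g) : PT C fun a => f a * g a := by
  obtain ⟨bf, hbf⟩ := hf.exists_le
  obtain ⟨bg, hbg⟩ := hg.exists_le
  refine recOn (v := fun a k => f a * k) (g := fun a _ acc => acc + f a) (bf * bg) hg zero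
    (snd.add hf.fst.fst) (fun _ _ _ => rfl) fun a k hk => ?_
  rw [Polynomial.eval_mul]
  exact Nat.mul_le_mul (hbf a) (hk.trans (hbg a))

-- A recursion of `ind (P a)` rounds, hence none or one, that starts at `g a` and steps to `f a`.
open Classical in
theorem ite {P : α → Prop} {f g : α → ℕ} (hP : PTP C P) (hf : PT C f) (hg : PT C g) :
    PT C fun a => if P a then f a else g a := by
  obtain ⟨bf, hbf⟩ := hf.exists_le
  obtain ⟨bg, hbg⟩ := hg.exists_le
  refine (recOn (n := fun a => ind (P a)) (v := fun a k => if k = 0 then g a else f a)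
    (g := fun a _ _ => f a) (bf + bg) hP (by simpa using hg) hf.fst.fst (fun _ _ _ => rfl)
    fun a k hk => ?_).of_eq fun a => ?_
  · rw [Polynomial.eval_add]
    have := hbf a
    have := hbg a
    split_ifs <;> omega
  · by_cases h : P a
    · rw [ind_true h, if_pos h]
      rfl
    · rw [ind_false h, if_neg h]
      rfl

theorem sum {n : α → ℕ} {f : α → ℕ → ℕ} (hn : PT C n) (hf : PT C fun p : α × ℕ => f p.1 p.2) :
    PT C fun a => ∑ i ∈ Finset.range (n a), f a i := by
  obtain ⟨bn, hbn⟩ := hn.exists_le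
  obtain ⟨b, q, hbf, hp⟩ := id hf
  refine recOn (v := fun a k => ∑ i ∈ Finset.range k, f a i) (g := fun a i acc => acc + f a i)
    (bn * b.comp (.X + bn)) hn (by simpa using zero) (snd.add hf.fst)
    (fun a k _ => Finset.sum_range_succ _ _) fun a k hk => ?_
  rw [Polynomial.eval_mul, Polynomial.eval_comp]
  refine (Finset.sum_le_card_nsmul _ _ (b.eval ((Polynomial.X + bn).eval (Env.size a)))
    fun i hi => ?_).trans ?_
  · refine (hbf (a, i)).trans (eval_le_eval _ ?_)
    rw [Env.size_prod, Polynomial.eval_add, Polynomial.eval_X]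
    have := Finset.mem_range.1 hi
    have := hbn a
    dsimp only
    omega
  · rw [Finset.card_range, smul_eq_mul]
    exact Nat.mul_le_mul_right _ (hk.trans (hbn a))

end PT

/-! ### Connectives, comparisons, bounded quantifiers and letters of words -/

namespace PTP

theorem of_iff {P Q : α → Prop} (hP : PTP C P) (h : ∀ a, P a ↔ Q a) : PTP C Q :=
  (funext fun a => propext (h a) : P = Q) ▸ hP

theorem pos {f : α → ℕ} (hf : PT C f) : PTP C fun a => 0 < f a := by
  refine (PT.recOn (v := fun a k => ind (0 < k)) (g := fun _ _ _ => 1) 1 hf (PT.zero.of_eq ?_)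
    (PT.const 1) ?_ ?_).of_eq fun _ => rfl
  · exact fun a => (ind_false (lt_irrefl 0)).symm
  · exact fun a k _ => ind_true k.succ_pos
  · intro a k _
    simpa using ind_le_one _

theorem not {P : α → Prop} (hP : PTP C P) : PTP C fun a => ¬P a := by
  refine PT.of_eq ((PT.const 1).sub hP) fun a => ?_
  by_cases h : P a
  · rw [ind_true h, ind_false (not_not_intro h)]
  · rw [ind_false h, ind_true h]

theorem and {P Q : α → Prop} (hP : PTP C P) (hQ : PTP C Q) : PTP C fun a => P a ∧ Q a := by
  refine PT.of_eq (PT.mul hP hQ) fun a => ?_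
  by_cases h : P a
  · by_cases h' : Q a
    · rw [ind_true h, ind_true h', ind_true ⟨h, h'⟩]
    · rw [ind_false h', ind_false fun h : P a ∧ Q a => h' h.2, Nat.mul_zero]
  · rw [ind_false h, ind_false fun h' : P a ∧ Q a => h h'.1, Nat.zero_mul]

theorem or {P Q : α → Prop} (hP : PTP C P) (hQ : PTP C Q) : PTP C fun a => P a ∨ Q a :=
  (hP.not.and hQ.not).not.of_iff fun a => by tauto

theorem imp {P Q : α → Prop} (hP : PTP C P) (hQ : PTP C Q) : PTP C fun a => P a → Q a :=
  (hP.and hQ.not).not.of_iff fun a => by tauto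

theorem iff {P Q : α → Prop} (hP : PTP C P) (hQ : PTP C Q) : PTP C fun a => P a ↔ Q a :=
  ((hP.imp hQ).and (hQ.imp hP)).of_iff fun a => by tauto

theorem lt {f g : α → ℕ} (hf : PT C f) (hg : PT C g) : PTP C fun a => f a < g a :=
  (pos (hg.sub hf)).of_iff fun a => by omega

theorem le {f g : α → ℕ} (hf : PT C f) (hg : PT C g) : PTP C fun a => f a ≤ g a :=
  (lt hg hf).not.of_iff fun a => by omega

theorem eq {f g : α → ℕ} (hf : PT C f) (hg : PT C g) : PTP C fun a => f a = g a :=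
  ((le hf hg).and (le hg hf)).of_iff fun a => by omega

/-- A bounded existential statement says that the sum of the indicators is positive. -/
theorem ex {n : α → ℕ} {P : α → ℕ → Prop} (hn : PT C n) (hP : PTP C fun p : α × ℕ => P p.1 p.2) :
    PTP C fun a => ∃ x < n a, P a x :=
  (pos (PT.sum (f := fun a x => ind (P a x)) hn hP)).of_iff fun a => by
    simp only [Finset.sum_pos_iff, Finset.mem_range]
    refine exists_congr fun x => and_congr_right fun _ => ?_
    by_cases h : P a x
    · exact ⟨fun _ => h, fun _ => (ind_true h).symm ▸ one_pos⟩
    · exact ⟨fun h' => absurd ((ind_false h) ▸ h') (lt_irrefl 0), fun h' => absurd h' h⟩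

theorem all {n : α → ℕ} {P : α → ℕ → Prop} (hn : PT C n) (hP : PTP C fun p : α × ℕ => P p.1 p.2) :
    PTP C fun a => ∀ x < n a, P a x :=
  (ex (P := fun a x => ¬P a x) hn hP.not).not.of_iff fun a => by simp

/-- Access to the letters of a word. -/
theorem bit (i : Fin 3) {f : α → ℕ} (hf : PT C f) :
    PTP C fun a => (Env.word a i).getD (f a) false = true := by
  obtain ⟨b, q, hb, hp⟩ := hf
  refine ⟨1, q + ((b * 3 + 1) + (3 + (2 * .X + 1))), fun a => by simpa using ind_le_one _,
    fun regs d hd hr => ?_⟩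
  obtain ⟨p, hp⟩ := hp regs (d + 1) (by omega) fun r h => (hr r h).trans (by omega)
  -- The first `f a` letters are shifted to `d + 2`, the next one is inspected and put back, and the
  -- shifted ones return. An exhausted word leads to `skip`, which gives the default value `false`.
  refine ⟨.seq p (.seq (.loop (d + 1) fun _ => .case i fun o => o.elim .skip fun a => .push (d + 2) a)
    (.seq (.case i fun o => o.elim .skip fun a => .seq (.push i a)
      (if a = some true then .push d (some true) else .skip)) (.move (d + 2) i))), fun a s h => ?_⟩
  have hi : (i : ℕ) < 3 := i.2
  set w := (Env.word a i).map some with hw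
  have hwl : w.length ≤ Env.size a := by simpa [hw] using Env.length_word_le a i
  have hsi : s i = w := h.word i
  have hd0 := h.free d le_rfl
  have hd1 := h.free (d + 1) (by omega)
  have hd2 := h.free (d + 2) (by omega)
  have r1 := hp a s (h.congr hd hr (fun _ _ => rfl) fun r hr => h.free r (by omega))
  set S : ℕ → Store := fun k =>
    update (update (update s (d + 1) (unary (f a - k))) i (w.drop k)) (d + 2) (w.take k).reverse
    with hS
  have hS0 : S 0 = update s (d + 1) (unary (f a)) := by
    funext x
    simp only [hS, update_apply, List.drop_zero, List.take_zero, List.reverse_nil, Nat.sub_zero]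
    grind
  have r2 : RunsIn C (.loop (d + 1) fun _ => .case i fun o => o.elim .skip fun a => .push (d + 2) a)
      (S 0) ((unary (f a)).length * (2 + 1) + 1) (S (unary (f a)).length) := by
    apply RunsIn.loop
    · intro k
      simp only [hS, update_apply, drop_unary]
      grind
    intro k hk
    have e1 : update (S k) (d + 1) ((unary (f a)).drop (k + 1)) i = w.drop k := by
      simp only [hS, update_apply]
      grind
    refine RunsIn.case (T := 1) ?_
    rw [e1]
    rcases Nat.lt_or_ge k w.length with hkw | hkw
    · rw [List.drop_eq_getElem_cons hkw]
      refine (RunsIn.push _ _ _).congr le_rfl ?_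
      funext x
      simp only [hS, update_apply, drop_unary, List.take_succ_eq_append_getElem hkw,
        List.reverse_append, List.tail_cons, List.reverse_singleton, List.singleton_append]
      grind
    · rw [List.drop_eq_nil_of_le hkw]
      refine (RunsIn.skip _).congr le_rfl ?_
      funext x
      simp only [hS, update_apply, drop_unary, List.take_of_length_le hkw,
        List.take_of_length_le (hkw.trans k.le_succ), List.drop_eq_nil_of_le hkw,
        List.drop_eq_nil_of_le (hkw.trans k.le_succ), List.tail_nil]
      grind
  rw [length_unary, hS0] at r2
  set m := f a with hm
  have e2 : S m i = w.drop m := by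
    simp only [hS, update_apply]
    grind
  have r3 : RunsIn C (.case i fun o => o.elim .skip fun a => .seq (.push i a)
      (if a = some true then .push d (some true) else .skip)) (S m) 3
      (update (S m) d (unary (ind ((Env.word a i).getD m false = true)))) := by
    refine RunsIn.case (T := 2) ?_
    rw [e2]
    rcases Nat.lt_or_ge m w.length with hmw | hmw
    · have hmw' : m < (Env.word a i).length := by simpa [hw] using hmw
      rw [List.drop_eq_getElem_cons hmw]
      have e3 : w[m] = some ((Env.word a i).getD m false) := by
        simp [hw, hmw']
      refine RunsIn.seq (T := 1) (T' := 1) (RunsIn.push _ _ _) ?_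
      rw [e3]
      cases hbit : (Env.word a i).getD m false
      · rw [if_neg (by simp), ind_false (by simp)]
        refine (RunsIn.skip _).congr le_rfl ?_
        funext x
        rw [hbit] at e3
        simp only [hS, update_apply, List.tail_cons, unary_zero,
          List.drop_eq_getElem_cons hmw, e3]
        grind
      · rw [if_pos rfl, ind_true rfl]
        refine (RunsIn.push _ _ _).congr le_rfl ?_
        funext x
        rw [hbit] at e3
        simp only [hS, update_apply, List.tail_cons, unary_succ, unary_zero,
          List.drop_eq_getElem_cons hmw, e3]
        grind
    · have hmw' : (Env.word a i).length ≤ m := by simpa [hw] using hmw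
      rw [List.drop_eq_nil_of_le hmw, ind_false (by
        rw [List.getD_eq_default _ _ hmw']
        simp)]
      refine (RunsIn.skip _).congr one_le_two ?_
      funext x
      simp only [hS, update_apply, List.drop_eq_nil_of_le hmw, unary_zero, List.tail_nil]
      grind
  refine (r1.seq (r2.seq (r3.seq (RunsIn.move (r := d + 2) (r' := i) (by omega) _)))).congr ?_ ?_
  · have e3 : (update (S m) d (unary (ind ((Env.word a i).getD m false = true))) (d + 2)).length ≤
        Env.size a := by
      simp only [hS, update_apply]
      rw [if_neg (by omega), if_pos trivial]
      simp
      omega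
    simp only [Polynomial.eval_add, Polynomial.eval_mul, Polynomial.eval_ofNat,
      Polynomial.eval_one, Polynomial.eval_X]
    have := hb a
    omega
  · funext x
    have e4 : (w.take m).reverse.reverse ++ w.drop m = w := by simp
    by_cases x1 : x = i
    · subst x1
      rw [update_self, update_of_ne (by omega), update_of_ne (by omega), update_of_ne (by omega),
        e2, hsi]
      simp [hS]
    · simp only [hS, update_apply, Nat.sub_self, unary_zero]
      grind

end PTP

/-! ### The output length of a machine -/

/-- The number of pushes in a statement. -/
def pushCount {K : Type} {Γ : K → Type} {Λ σ : Type} : TM2.Stmt Γ Λ σ → ℕ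
  | .push _ _ q => pushCount q + 1
  | .peek _ _ q => pushCount q
  | .pop _ _ q => pushCount q
  | .load _ q => pushCount q
  | .branch _ q q' => pushCount q + pushCount q'
  | .goto _ => 0
  | .halt => 0

/-- A stack grows only by pushes; `pushCount` adds up both branches, an overestimate that suffices.
-/
theorem length_stepAux_le {K : Type} [DecidableEq K] {Γ : K → Type} {Λ σ : Type}
    (q : TM2.Stmt Γ Λ σ) (v : σ) (S : ∀ k, List (Γ k)) (k : K) :
    ((TM2.stepAux q v S).stk k).length ≤ (S k).length + pushCount q := by
  induction q generalizing v S with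
  | push k' f q ih =>
    refine (ih v _).trans ?_
    by_cases h : k = k'
    · subst h
      simp [pushCount]
      omega
    · simp [update_of_ne h, pushCount]
  | peek k' f q ih => exact ih _ _
  | pop k' f q ih =>
    refine (ih _ _).trans ?_
    by_cases h : k = k'
    · subst h
      simp [pushCount]
    · simp [update_of_ne h, pushCount]
  | load f q ih => exact ih _ _
  | branch f q q' ih ih' =>
    simp only [TM2.stepAux, pushCount]
    cases f v
    · exact (ih' v S).trans (by omega)
    · exact (ih v S).trans (by omega)
  | goto f => simp [pushCount]
  | halt => simp [pushCount]

/-- There are finitely many labels, so the number of pushes in one step is bounded. -/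
theorem exists_length_le (tm : FinTM2) : ∃ B : ℕ, ∀ n (c c' : tm.Cfg) k,
    ReachesIn tm.step n c c' → (c'.stk k).length ≤ (c.stk k).length + n * B := by
  let := tm.ΛFin
  refine ⟨Finset.univ.sup fun l => pushCount (tm.m l), fun n => ?_⟩
  induction n with
  | zero =>
    intro c c' k h
    cases h
    simp
  | succ n ih =>
    intro c c' k h
    unfold ReachesIn at h
    rw [iterate_succ_apply'] at h
    obtain ⟨d, hd, hdc⟩ : ∃ d, ReachesIn tm.step n c d ∧ tm.step d = some c' := by
      cases hd : (flip bind tm.step)^[n] (some c) with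
      | none => rw [hd] at h; cases h
      | some d => rw [hd] at h; exact ⟨d, hd, h⟩
    have h1 := ih c d k hd
    obtain ⟨_ | l, v, S⟩ := d
    · cases hdc
    · cases hdc
      refine (length_stepAux_le (tm.m l) v S k).trans ?_
      have h2 : pushCount (tm.m l) ≤ Finset.univ.sup fun l => pushCount (tm.m l) :=
        Finset.le_sup (f := fun l => pushCount (tm.m l)) (Finset.mem_univ l)
      rw [add_one_mul]
      change (S k).length ≤ _ at h1
      omega

/-- The word returned by the subroutine is an input of the later computation, whose time bound
refers to its length. -/
theorem exists_output_length_le (C : TM2ComputableAux Bool Bool) : ∃ B : ℕ, ∀ (l l' : List Bool) t,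
    TM2OutputsInTime C.tm (l.map C.inputAlphabet.invFun) (some (l'.map C.outputAlphabet.invFun)) t →
    l'.length ≤ l.length + t * B := by
  obtain ⟨B, hB⟩ := exists_length_le C.tm
  refine ⟨B, fun l l' t h => ?_⟩
  have h1 := hB h.steps _ _ C.tm.k₁ h.evals_in_steps
  rw [haltList_stk, initList_stk, update_self, List.length_map] at h1
  have h2 : (update (fun _ => []) C.tm.k₀ (l.map C.inputAlphabet.invFun) C.tm.k₁ :
      List (C.tm.Γ C.tm.k₁)).length ≤ l.length := by
    -- Input and output may share a stack. A bound for every stack avoids transporting the word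
    -- along the equality of indices.
    by_cases h : C.tm.k₁ = C.tm.k₀
    · have : ∀ k, (update (fun k => ([] : List (C.tm.Γ k))) C.tm.k₀
          (l.map C.inputAlphabet.invFun) k).length ≤ l.length := by
        intro k
        by_cases hk : k = C.tm.k₀
        · subst hk
          simp
        · simp [update_of_ne hk]
      exact this _
    · simp [update_of_ne h]
  have h3 := Nat.mul_le_mul_right B h.steps_le_m
  omega

/-! ### Decision procedures with one call of the subroutine -/

section

variable {C : TM2ComputableAux Bool Bool}

/-- The store that holds three words. -/
def wordStore (w : Fin 3 → List Bool) : Store :=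
  fun r => if h : r < 3 then (w ⟨r, h⟩).map some else []

theorem holds_of_wordStore {w : Fin 3 → List Bool} {s : Store} {d : ℕ}
    (hs : ∀ r < 3, s r = wordStore w r) (hd : ∀ r ≥ d, s r = []) : Holds w [] d s where
  word i := by
    rw [hs i i.2, wordStore, dif_pos i.2]
    rfl
  vars := .nil
  free := hd

/-- Splits the word `encodePair (x, c)` in register `0` into `x` in register `0` and `c` in
register `1`. -/
def Prog.split : Prog :=
  .seq (.move 0 3) (.seq (.loop 3 fun a => a.elim (.move 0 4) fun b => .push 0 (some b))
    (.move 4 1))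

theorem RunsIn.split_loop (l : List Bool) (rest : List Sym) (s s' : Store) (T : ℕ)
    (hs : s 3 = l.map some ++ rest)
    (h : RunsIn C (.loop 3 fun a => a.elim (.move 0 4) fun b => .push 0 (some b))
      (update (update s 3 rest) 0 ((l.map some).reverse ++ s 0)) T s') :
    RunsIn C (.loop 3 fun a => a.elim (.move 0 4) fun b => .push 0 (some b)) s
      (2 * l.length + T) s' := by
  induction l generalizing s with
  | nil =>
    have : update (update s 3 rest) 0 ((([] : List Bool).map some).reverse ++ s 0) = s := by
      simp only [List.map_nil, List.nil_append] at hs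
      rw [← hs]
      simp
    rw [this] at h
    exact h.mono (by simp)
  | cons b l ih =>
    have h1 := ih (update (update s 3 (l.map some ++ rest)) 0 (some b :: s 0))
      (by simp) (by
        convert h using 1
        funext x
        simp only [update_apply]
        grind)
    refine (RunsIn.loop_cons (p := fun a => a.elim (.move 0 4) fun b => .push 0 (some b))
      (l := l.map some ++ rest) hs ((RunsIn.push 0 (some b) _).congr le_rfl (by
        rw [update_of_ne (by omega : (0 : ℕ) ≠ 3)])) h1).mono (T := 1 + 1 + (2 * l.length + T)) ?_
    simp only [List.length_cons]
    omega

/-- After the first move, register `3` holds `c` reversed, the separator and `x` reversed. The loop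
rebuilds `c` in register `0`, stores it away in `4` at the separator, and then rebuilds `x` in `0`.
-/
theorem RunsIn.split (x c : List Bool) :
    RunsIn C .split (update (fun _ => []) 0 (encodePair (x, c)))
      (8 * (encodePair (x, c)).length + 8) (wordStore ![x, c, []]) := by
  have h2 := (RunsIn.move (C := C) (r := 0) (r' := 4) (by omega)
    (update (update (update (fun _ => []) 3 (none :: x.reverse.map some)) 0 (c.map some)) 3
      (x.reverse.map some)))
  have h3 := RunsIn.split_loop (C := C) x.reverse [] (update (update (fun _ => []) 4
    (c.map some).reverse) 3 (x.reverse.map some)) _ 1 (by simp) (RunsIn.loop_nil (by simp))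
  have h4 := RunsIn.loop_cons (r := 3) (p := fun a => a.elim (.move 0 4) fun b => .push 0 (some b))
    (s := update (update (fun _ => []) 3 (none :: x.reverse.map some)) 0 (c.map some))
    (a := none) (l := x.reverse.map some) (by simp) h2 (by
      convert h3 using 1
      funext r
      simp only [update_apply]
      grind)
  have h5 := RunsIn.split_loop (C := C) c.reverse (none :: x.reverse.map some)
    (update (fun _ => []) 3 (encodePair (x, c)).reverse) _ _ (by simp [encodePair]) (by
      convert h4 using 1
      funext r
      simp only [update_apply]
      simp
      grind)
  refine ((RunsIn.move (r := 0) (r' := 3) (by omega) _).seq (RunsIn.seq (T := _) (by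
    convert h5 using 1
    funext r
    simp only [update_apply]
    simp
    grind) (RunsIn.move (r := 4) (r' := 1) (by omega) _))).congr ?_ ?_
  · simp [encodePair]
    omega
  · funext r
    simp only [update_apply, wordStore]
    rcases r with _ | _ | _ | r
    · simp
    · simp
    · simp
    · simp
      grind

theorem size_words (w : Fin 3 → List Bool) :
    Env.size w = (w 0).length + (w 1).length + (w 2).length := by
  simp [Env.size, Env.word, Env.vars, Fin.sum_univ_three]

/-- A predicate of a pair `(x, c)` and the word that the subroutine returns for a number format
computed from `(x, c)` can be decided in polynomial time. -/
theorem nonempty_computable_of_call {F : ℕ+ × ℕ+ → List Bool}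
    (D : TM2ComputableInPolyTime encodeFormat id F) {n m : (Fin 3 → List Bool) → ℕ+}
    {P : (Fin 3 → List Bool) → Prop} (hn : PT D.toTM2ComputableAux fun w => (n w : ℕ))
    (hm : PT D.toTM2ComputableAux fun w => (m w : ℕ)) (hP : PTP D.toTM2ComputableAux P)
    {V : List Bool × List Bool → Bool}
    (hV : ∀ x c, V (x, c) = true ↔
      P ![x, c, F (n ![x, c, []], m ![x, c, []])]) :
    Nonempty (TM2ComputableInPolyTime encodePair Computability.encodeBool V) := by
  obtain ⟨bn, qn, hbn, hn⟩ := hn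
  obtain ⟨bm, qm, hbm, hm⟩ := hm
  obtain ⟨bP, qP, hbP, hP⟩ := hP
  obtain ⟨pn, hn⟩ := hn [] 3 le_rfl (by simp)
  obtain ⟨pm, hm⟩ := hm [] 4 (by omega) (by simp)
  obtain ⟨pP, hP⟩ := hP [] 3 le_rfl (by simp)
  obtain ⟨B, hB⟩ := exists_output_length_le D.toTM2ComputableAux
  -- Registers `3` and `4` receive the two unary numbers; moving and adding terminators produces the
  -- reversed format code in `3`, as the call requires. The reversed result in `4` is straightened
  -- by the move to `2`.
  let p : Prog := .seq .split (.seq pn (.seq (.push 3 (some false)) (.seq pm (.seq (.move 4 3)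
    (.seq (.push 3 (some false)) (.seq (.call 3 4) (.seq (.move 4 2) (.seq pP
      (.seq (.clear 0) (.seq (.clear 1) (.clear 2)))))))))))
  -- Bounds for the length of the format code (with two terminators), for the time of the subroutine
  -- and for the length of its result.
  let bl : Polynomial ℕ := bn + bm + 2
  let bt : Polynomial ℕ := D.time.comp bl
  let bu : Polynomial ℕ := bl + bt * B
  let q : Polynomial ℕ := (8 * .X + 8) + (qn + (1 + (qm + ((2 * bm + 1) + (1 +
    ((bl + 1 + bt + (bu + 1)) + ((2 * bu + 1) + (qP.comp (.X + bu) + ((2 * .X + 1) +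
      ((2 * .X + 1) + (2 * bu + 1)))))))))))
  refine nonempty_computable_of_runs D.toTM2ComputableAux p q ?_
  rintro ⟨x, c⟩
  set L := (encodePair (x, c)).length with hL
  have hLs : L = x.length + (c.length + 1) := by simp [hL, encodePair]
  set w : Fin 3 → List Bool := ![x, c, []] with hw
  have hsz : Env.size w ≤ L := by
    rw [size_words, hLs]
    simp [hw]
  set N := (n w : ℕ) with hN
  set M := (m w : ℕ) with hM
  set u := F (n w, m w) with hu
  set w' : Fin 3 → List Bool := ![x, c, u] with hw'
  have r1 := RunsIn.split (C := D.toTM2ComputableAux) x c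
  have r2 := (hn w _ (holds_of_wordStore (fun _ _ => rfl) fun r hr => by
    simp [wordStore, hr])).mono (eval_le_eval _ hsz)
  have r4 := (hm w (update (update (wordStore w) 3 (unary N)) 3 (some false :: unary N))
    (holds_of_wordStore (fun r hr => by
      rw [update_of_ne (by omega), update_of_ne (by omega)]) fun r hr => by
    rw [update_of_ne (by omega), update_of_ne (by omega)]
    simp [wordStore]
    omega)).mono (eval_le_eval _ hsz)
  have hNb : N ≤ bn.eval L := (hbn w).trans (eval_le_eval _ hsz)
  have hMb : M ≤ bm.eval L := (hbm w).trans (eval_le_eval _ hsz)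
  set f := encodeFormat (n w, m w) with hf
  have hfl : f.length = N + 1 + (M + 1) := by
    simp [hf, encodeFormat, encodeUnary, hN, hM]
    omega
  have hflb : f.length ≤ bl.eval L := by
    rw [hfl]
    simp only [bl, Polynomial.eval_add, Polynomial.eval_ofNat]
    omega
  have hD := D.outputsFun (n w, m w)
  have hul : u.length ≤ bu.eval L := by
    refine (hB _ _ _ hD).trans ?_
    simp only [bu, bt, Polynomial.eval_add, Polynomial.eval_mul, Polynomial.eval_natCast,
      Polynomial.eval_comp]
    have := Nat.mul_le_mul_right B (eval_le_eval D.time hflb)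
    exact add_le_add hflb this
  have htb : D.time.eval f.length ≤ bt.eval L := by
    simp only [bt, Polynomial.eval_comp]
    exact eval_le_eval _ hflb
  have hfr : (f.map some).reverse = some false :: (unary M ++ some false :: unary N) := by
    simp [hf, encodeFormat, encodeUnary, unary, hN, hM]
  have r7 : RunsIn D.toTM2ComputableAux (.call 3 4) (update (wordStore w) 3 (f.map some).reverse)
      (bl.eval L + 1 + bt.eval L + (bu.eval L + 1))
      (update (wordStore w) 4 (u.map some).reverse) := by
    refine RunsIn.congr ⟨_, le_rfl, Runs.call (l := f) (by simp) ⟨hD⟩⟩ ?_ ?_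
    · change f.length + 1 + D.time.eval f.length + (u.length + 1) ≤ _
      gcongr
    · funext r
      change update (update (update (wordStore w) 3 (f.map some).reverse) 3 []) 4
        ((u.map some).reverse ++ update (update (wordStore w) 3 (f.map some).reverse) 3 [] 4) r = _
      have h3 : wordStore w 3 = [] := rfl
      have h4 : wordStore w 4 = [] := rfl
      simp only [update_apply]
      grind
  have hsz' : Env.size w' ≤ L + bu.eval L := by
    rw [size_words]
    simp only [hw', Matrix.cons_val_zero, Matrix.cons_val_one, Matrix.cons_val]
    omega
  have r9 := (hP w' (wordStore w') (holds_of_wordStore (fun _ _ => rfl) fun r hr => by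
    simp [wordStore, hr])).mono (eval_le_eval _ hsz')
  have e4 : wordStore w 4 = [] := rfl
  have e3 : wordStore w 3 = [] := rfl
  have hlast : (if V (x, c) = true then [some true] else []) = unary (ind (P w')) := by
    by_cases h : P w'
    · rw [ind_true h, if_pos ((hV x c).2 h)]
      rfl
    · rw [ind_false h, if_neg (fun h' => h ((hV x c).1 h'))]
      rfl
  have r3 : RunsIn D.toTM2ComputableAux (.push 3 (some false)) (update (wordStore w) 3 (unary N)) 1
      (update (wordStore w) 3 (some false :: unary N)) :=
    (RunsIn.push _ _ _).congr le_rfl (by rw [update_self, update_idem])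
  rw [update_idem] at r4
  have r5 : RunsIn D.toTM2ComputableAux (.move 4 3)
      (update (update (wordStore w) 3 (some false :: unary N)) 4 (unary M)) (2 * bm.eval L + 1)
      (update (wordStore w) 3 (unary M ++ some false :: unary N)) := by
    refine (RunsIn.move (by omega) _).congr (by simpa using hMb) ?_
    funext r
    by_cases r3 : r = 3
    · subst r3
      simp
    by_cases r4 : r = 4
    · subst r4
      simp [e4]
    simp [r3, r4]
  have r6 : RunsIn D.toTM2ComputableAux (.push 3 (some false))
      (update (wordStore w) 3 (unary M ++ some false :: unary N)) 1
      (update (wordStore w) 3 (f.map some).reverse) :=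
    (RunsIn.push _ _ _).congr le_rfl (by rw [update_self, update_idem, hfr])
  have r8 : RunsIn D.toTM2ComputableAux (.move 4 2) (update (wordStore w) 4 (u.map some).reverse)
      (2 * bu.eval L + 1) (wordStore w') := by
    refine (RunsIn.move (by omega) _).congr (by simpa using hul) ?_
    funext r
    simp only [update_apply, wordStore]
    rcases r with _ | _ | _ | _ | _ | r <;> simp [hw, hw']
  have r10 : RunsIn D.toTM2ComputableAux (.seq (.clear 0) (.seq (.clear 1) (.clear 2)))
      (update (wordStore w') 3 (unary (ind (P w'))))
      ((2 * L + 1) + ((2 * L + 1) + (2 * bu.eval L + 1)))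
      (update (fun _ => []) 3 (if V (x, c) = true then [some true] else [])) := by
    refine ((RunsIn.clear _ _).seq ((RunsIn.clear _ _).seq (RunsIn.clear _ _))).congr ?_ ?_
    · have h0 : ((wordStore w') 0).length = x.length := by simp [wordStore, hw']
      have h1 : ((wordStore w') 1).length = c.length := by simp [wordStore, hw']
      have h2 : ((wordStore w') 2).length = u.length := by simp [wordStore, hw']
      refine add_le_add ?_ (add_le_add ?_ ?_)
      · simp [h0]
        omega
      · simp [h1]
        omega
      · simpa [update_apply, h2] using hul
    · rw [hlast]
      funext r
      simp only [update_apply, wordStore]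
      rcases r with _ | _ | _ | _ | r <;> simp
  refine (r1.seq (r2.seq (r3.seq (r4.seq (r5.seq (r6.seq (r7.seq (r8.seq (r9.seq
    r10))))))))).mono ?_
  simp only [q, Polynomial.eval_add, Polynomial.eval_mul, Polynomial.eval_ofNat,
    Polynomial.eval_one, Polynomial.eval_X, Polynomial.eval_comp]
  exact le_rfl

end

/-! ### The verifier -/

/-- The letter at position `k` of the word `l` is `true`. -/
def Bit (l : List Bool) (k : ℕ) : Prop := l.getD k false = true

section Predicates

variable (w : Fin 3 → List Bool)

/-- The only `n` for which `w 0` can encode a pair of graphs on `n` vertices. -/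
noncomputable def order : ℕ :=
  ∑ k ∈ Finset.range (w 0).length, ind (2 * (k + 1 + k * k) < (w 0).length)

/-- The length of the code of a graph on `order w` vertices. -/
noncomputable def codeLength : ℕ := order w + 1 + order w * order w

/-- The entry `(i, j)` of the adjacency matrix of graph number `g`. -/
def AdjBit (g i j : ℕ) : Prop :=
  Bit (w 0) (g * codeLength w + (order w + 1) + (i * order w + j))

/-- Relation number `t` of the certificate `w 1`. -/
def CertRel (t a b : ℕ) : Prop := Bit (w 1) (4 * (a * (order w * order w) + b) + t)

/-- Relation number `t` of the certificate is a permutation of the numbers below `N`. -/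
def CertPerm (t N : ℕ) : Prop :=
  (∀ a < N, ∃ b < N, CertRel w t a b) ∧
    ∀ a < N, ∀ b < N, ∀ a' < N, ∀ b' < N, CertRel w t a b → CertRel w t a' b' → (a = a' ↔ b = b')

/-- The incidence matrix of graph number `g`, permuted according to the certificate. -/
def CertMatrix (g r e : ℕ) : Prop :=
  ∃ v < order w, ∃ i < order w, ∃ j < order w, CertRel w (2 * g) r v ∧
    CertRel w (2 * g + 1) e (i * order w + j) ∧ AdjBit w g i j ∧ (v = i ∨ v = j)

/-- The word `w 0` encodes two graphs on the same number of vertices. -/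
def IsGraphPair : Prop :=
  (w 0).length = 2 * codeLength w ∧ ∀ g < 2, (∀ i < order w, Bit (w 0) (g * codeLength w + i)) ∧
    ¬Bit (w 0) (g * codeLength w + order w) ∧ ∀ i < order w, ¬AdjBit w g i i ∧
      ∀ j < order w, AdjBit w g i j → AdjBit w g j i

/-- The literal that starts at position `p` of `w 2` is true in the assignment `B`. -/
def LitTrue (B : ℕ → ℕ → Prop) (p : ℕ) : Prop :=
  ∃ i < (w 2).length, ∃ j < (w 2).length, (∀ k < i, Bit (w 2) (p + 1 + k)) ∧
    ¬Bit (w 2) (p + 1 + i) ∧ (∀ k < j, Bit (w 2) (p + 2 + i + k)) ∧ ¬Bit (w 2) (p + 2 + i + j) ∧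
      (B i j ↔ Bit (w 2) p)

open Classical in
/-- The transitions of an automaton that reads the code of a formula. Its states are: `0` at the
start of a clause, `1` for a satisfied formula, `2` for an unsatisfied formula, and then `3`, `5`,
`7`, `9` before the tag, the sign, the row and the column of a literal in a clause that is
unsatisfied so far, and `4`, `6`, `8`, `10` in a satisfied clause. -/
noncomputable def cnfStep (s : ℕ) (b l : Prop) : ℕ :=
  if s = 0 then if b then 3 else 1
  else if s = 3 then if b then 5 else 2
  else if s = 4 then if b then 6 else 0
  else if s = 5 then if l then 8 else 7
  else if s = 6 then 8
  else if 7 ≤ s ∧ s < 9 then if b then s else s + 2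
  else if 9 ≤ s ∧ s < 11 then if b then s else s - 6
  else s

/-- The state of the automaton at position `p` of `w 2`. -/
noncomputable def cnfState (B : ℕ → ℕ → Prop) : ℕ → ℕ
  | 0 => 0
  | p + 1 => cnfStep (cnfState B p) (Bit (w 2) p) (LitTrue w B p)

/-- The formula encoded by `w 2` is satisfied by the assignment `B`. -/
def CnfTrue (B : ℕ → ℕ → Prop) : Prop := cnfState w B (w 2).length = 1

/-- The condition checked by the verifier for the input `w 0`, the certificate `w 1` and the
symmetry breaking predicate `w 2`. -/
def Accept : Prop :=
  -- A word that codes no pair of graphs of equal order is outside `GI` and is accepted at once.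
  -- Order zero is rejected because graphs without vertices are isomorphic.
  ¬IsGraphPair w ∨ (0 < order w ∧
    (CertPerm w 0 (order w) ∧ CertPerm w 1 (order w * order w)) ∧
    (CertPerm w 2 (order w) ∧ CertPerm w 3 (order w * order w)) ∧
    (∃ r < order w, ∃ e < order w * order w, ¬(CertMatrix w 0 r e ↔ CertMatrix w 1 r e)) ∧
    CnfTrue w (CertMatrix w 0) ∧ CnfTrue w (CertMatrix w 1))

end Predicates

/-! ### The verifier runs in polynomial time -/

section PolyTime

variable {C : TM2ComputableAux Bool Bool} {α : Type} [Env α]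

theorem ptp_bit (i : Fin 3) {f : α → ℕ} (hf : PT C f) :
    PTP C fun a => Bit (Env.word a i) (f a) := PTP.bit i hf

theorem pt_order : PT C fun a : α => order (Env.word a) :=
  PT.sum (PT.length 0) (PTP.lt ((PT.const 2).mul ((PT.snd.add (PT.const 1)).add
    (PT.snd.mul PT.snd))) (PT.length (α := α × ℕ) 0))

theorem pt_codeLength : PT C fun a : α => codeLength (Env.word a) :=
  (pt_order.add (PT.const 1)).add (pt_order.mul pt_order)

theorem ptp_adjBit {g i j : α → ℕ} (hg : PT C g) (hi : PT C i) (hj : PT C j) :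
    PTP C fun a => AdjBit (Env.word a) (g a) (i a) (j a) :=
  ptp_bit 0 (((hg.mul pt_codeLength).add (pt_order.add (PT.const 1))).add
    ((hi.mul pt_order).add hj))

theorem ptp_certRel {t i j : α → ℕ} (ht : PT C t) (hi : PT C i) (hj : PT C j) :
    PTP C fun a => CertRel (Env.word a) (t a) (i a) (j a) :=
  ptp_bit 1 (((PT.const 4).mul ((hi.mul (pt_order.mul pt_order)).add hj)).add ht)

theorem ptp_certPerm {t n : α → ℕ} (ht : PT C t) (hn : PT C n) :
    PTP C fun a => CertPerm (Env.word a) (t a) (n a) :=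
  (PTP.all hn (PTP.ex hn.fst (ptp_certRel ht.fst.fst PT.snd.fst PT.snd))).and
    (PTP.all hn (PTP.all hn.fst (PTP.all hn.fst.fst (PTP.all hn.fst.fst.fst
      ((ptp_certRel ht.fst.fst.fst.fst PT.snd.fst.fst.fst PT.snd.fst.fst).imp
        ((ptp_certRel ht.fst.fst.fst.fst PT.snd.fst PT.snd).imp
          ((PTP.eq PT.snd.fst.fst.fst PT.snd.fst).iff (PTP.eq PT.snd.fst.fst PT.snd))))))))

theorem ptp_certMatrix {g r e : α → ℕ} (hg : PT C g) (hr : PT C r) (he : PT C e) :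
    PTP C fun a => CertMatrix (Env.word a) (g a) (r a) (e a) :=
  PTP.ex pt_order (PTP.ex pt_order.fst (PTP.ex pt_order.fst.fst
    ((ptp_certRel ((PT.const 2).mul hg.fst.fst.fst) hr.fst.fst.fst PT.snd.fst.fst).and
      ((ptp_certRel (((PT.const 2).mul hg.fst.fst.fst).add (PT.const 1)) he.fst.fst.fst
        ((PT.snd.fst.mul pt_order).add PT.snd)).and
        ((ptp_adjBit hg.fst.fst.fst PT.snd.fst PT.snd).and
          ((PTP.eq PT.snd.fst.fst PT.snd.fst).or (PTP.eq PT.snd.fst.fst PT.snd)))))))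

theorem ptp_isGraphPair : PTP C fun a : α => IsGraphPair (Env.word a) :=
  (PTP.eq (PT.length 0) ((PT.const 2).mul pt_codeLength)).and
    (PTP.all (PT.const 2)
      ((PTP.all pt_order.fst
        (ptp_bit 0 ((PT.snd.fst.mul pt_codeLength).add PT.snd))).and
      ((ptp_bit 0 ((PT.snd.mul pt_codeLength).add pt_order)).not.and
        (PTP.all pt_order.fst ((ptp_adjBit PT.snd.fst PT.snd PT.snd).not.and
          (PTP.all pt_order.fst.fst
            ((ptp_adjBit PT.snd.fst.fst PT.snd.fst PT.snd).imp
              (ptp_adjBit PT.snd.fst.fst PT.snd PT.snd.fst))))))))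

theorem ptp_litTrue {g p : α → ℕ} (hg : PT C g) (hp : PT C p) :
    PTP C fun a => LitTrue (Env.word a) (CertMatrix (Env.word a) (g a)) (p a) :=
  PTP.ex (PT.length 2) (PTP.ex (PT.length 2).fst
    ((PTP.all PT.snd.fst (ptp_bit 2 ((hp.fst.fst.fst.add (PT.const 1)).add PT.snd))).and
      ((ptp_bit 2 ((hp.fst.fst.add (PT.const 1)).add PT.snd.fst)).not.and
        ((PTP.all PT.snd (ptp_bit 2 (((hp.fst.fst.fst.add (PT.const 2)).add
          PT.snd.fst.fst).add PT.snd))).and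
          ((ptp_bit 2 (((hp.fst.fst.add (PT.const 2)).add PT.snd.fst).add PT.snd)).not.and
            ((ptp_certMatrix hg.fst.fst PT.snd.fst PT.snd).iff (ptp_bit 2 hp.fst.fst)))))))

theorem cnfStep_le {s : ℕ} (hs : s ≤ 10) (b l : Prop) : cnfStep s b l ≤ 10 := by
  unfold cnfStep
  split_ifs <;> omega

theorem cnfState_le (w : Fin 3 → List Bool) (B : ℕ → ℕ → Prop) (p : ℕ) : cnfState w B p ≤ 10 := by
  induction p with
  | zero => exact Nat.zero_le _
  | succ p ih => exact cnfStep_le ih _ _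

theorem pt_cnfStep {s : α → ℕ} {b l : α → Prop} (hs : PT C s) (hb : PTP C b) (hl : PTP C l) :
    PT C fun a => cnfStep (s a) (b a) (l a) :=
  PT.of_eq (PT.ite (PTP.eq hs (PT.const 0)) (PT.ite hb (PT.const 3) (PT.const 1))
  (PT.ite (PTP.eq hs (PT.const 3)) (PT.ite hb (PT.const 5) (PT.const 2))
  (PT.ite (PTP.eq hs (PT.const 4)) (PT.ite hb (PT.const 6) (PT.const 0))
  (PT.ite (PTP.eq hs (PT.const 5)) (PT.ite hl (PT.const 8) (PT.const 7))
  (PT.ite (PTP.eq hs (PT.const 6)) (PT.const 8)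
  (PT.ite ((PTP.le (PT.const 7) hs).and (PTP.lt hs (PT.const 9)))
    (PT.ite hb hs (hs.add (PT.const 2)))
  (PT.ite ((PTP.le (PT.const 9) hs).and (PTP.lt hs (PT.const 11)))
    (PT.ite hb hs (hs.sub (PT.const 6))) hs))))))) fun a => by
    unfold cnfStep
    split_ifs <;> rfl

/-- The run of the automaton is a bounded recursion over the positions of the word; the finitely
many states give the constant bound. -/
theorem ptp_cnfTrue {g : α → ℕ} (hg : PT C g) :
    PTP C fun a => CnfTrue (Env.word a) (CertMatrix (Env.word a) (g a)) := by
  refine PTP.eq (PT.recOn (v := fun a p => cnfState (Env.word a) (CertMatrix (Env.word a) (g a)) p)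
    (g := fun a p s => cnfStep s (Bit (Env.word a 2) p)
      (LitTrue (Env.word a) (CertMatrix (Env.word a) (g a)) p)) 10 (PT.length 2) PT.zero
    (pt_cnfStep PT.snd (ptp_bit (α := (α × ℕ) × ℕ) 2 PT.snd.fst)
      (ptp_litTrue (α := (α × ℕ) × ℕ) hg.fst.fst PT.snd.fst))
    (fun _ _ _ => rfl) fun a k _ => ?_) (PT.const 1)
  simpa using cnfState_le _ _ k

theorem ptp_accept : PTP C fun a : α => Accept (Env.word a) :=
  ptp_isGraphPair.not.or ((PTP.pos pt_order).and
    (((ptp_certPerm (PT.const 0) pt_order).and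
      (ptp_certPerm (PT.const 1) (pt_order.mul pt_order))).and
    (((ptp_certPerm (PT.const 2) pt_order).and
      (ptp_certPerm (PT.const 3) (pt_order.mul pt_order))).and
    ((PTP.ex pt_order (PTP.ex (pt_order.mul pt_order).fst
      ((ptp_certMatrix (PT.const 0) PT.snd.fst PT.snd).iff
        (ptp_certMatrix (PT.const 1) PT.snd.fst PT.snd)).not)).and
    ((ptp_cnfTrue (PT.const 0)).and (ptp_cnfTrue (PT.const 1)))))))

end PolyTime

/-! ### Correctness of the evaluation of formulas -/

theorem getD_of_drop {l a c : List Bool} {b : Bool} {p : ℕ} (h : l.drop p = a ++ b :: c) :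
    l.getD (p + a.length) false = b := by
  have h1 : (l.drop p).getD a.length false = b := by
    rw [h]
    simp
  rw [← h1]
  simp [List.getD_eq_getElem?_getD]

theorem drop_of_drop {l a c : List Bool} {p : ℕ} (h : l.drop p = a ++ c) :
    l.drop (p + a.length) = c := by
  rw [← List.drop_drop, h, List.drop_left]

theorem bit_of_drop {l a c : List Bool} {b : Bool} {p q : ℕ} (h : l.drop p = a ++ b :: c)
    (hq : q = p + a.length) : Bit l q ↔ b = true := by
  subst hq
  rw [Bit, getD_of_drop h]

theorem bit_of_drop_replicate {l a c : List Bool} {i p : ℕ}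
    (h : l.drop p = a ++ (List.replicate i true ++ c)) {k q : ℕ} (hk : k < i)
    (hq : q = p + a.length + k) : Bit l q := by
  have e : List.replicate i true = List.replicate k true ++ true :: List.replicate (i - k - 1) true := by
    rw [← List.replicate_succ, List.replicate_append_replicate]
    congr 1
    omega
  rw [e] at h
  refine (bit_of_drop (a := a ++ List.replicate k true) (b := true) (p := p)
    (c := List.replicate (i - k - 1) true ++ c) ?_ ?_).2 rfl
  · simpa using h
  · simp [hq]
    omega

section

variable {w : Fin 3 → List Bool} {B : ℕ → ℕ → Prop} {p : ℕ} {rest : List Bool}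

/-- Each unary number ends at its first `false`, so the indices quantified in `LitTrue` are forced
to be those of the variable. -/
theorem litTrue_iff {n m : ℕ} (v : Fin n × Fin m) (b : Bool)
    (h : (w 2).drop p = b :: (encodeVar v ++ rest)) :
    LitTrue w B p ↔ (B v.1 v.2 ↔ b = true) := by
  have h' : (w 2).drop p = [b] ++ (List.replicate v.1 true ++
      false :: (List.replicate v.2 true ++ false :: rest)) := by
    simpa [encodeVar, encodeUnary] using h
  have hlen : p + 1 + v.1 + 1 + v.2 + 1 ≤ (w 2).length := by
    have h1 := congrArg List.length h'
    simp at h1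
    omega
  have hb : Bit (w 2) p ↔ b = true := bit_of_drop (a := []) h rfl
  have hi : ∀ k < (v.1 : ℕ), Bit (w 2) (p + 1 + k) := fun k hk =>
    bit_of_drop_replicate h' hk rfl
  have hi' : ¬Bit (w 2) (p + 1 + v.1) := by
    rw [bit_of_drop (b := false) (a := [b] ++ List.replicate v.1 true)
      (by simpa using h') (by simp; omega)]
    simp
  have hj : ∀ k < (v.2 : ℕ), Bit (w 2) (p + 2 + v.1 + k) := fun k hk =>
    bit_of_drop_replicate (a := [b] ++ List.replicate v.1 true ++ [false]) (by simpa using h') hk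
      (by simp; omega)
  have hj' : ¬Bit (w 2) (p + 2 + v.1 + v.2) := by
    rw [bit_of_drop (b := false)
      (a := [b] ++ List.replicate v.1 true ++ [false] ++ List.replicate v.2 true)
      (by simpa using h') (by simp; omega)]
    simp
  constructor
  · rintro ⟨i, -, j, -, h1, h2, h3, h4, h5⟩
    have ei : i = v.1 := by
      rcases lt_trichotomy i v.1 with hlt | heq | hgt
      · exact absurd (hi i hlt) h2
      · exact heq
      · exact absurd (h1 _ hgt) hi'
    subst ei
    have ej : j = v.2 := by
      rcases lt_trichotomy j v.2 with hlt | heq | hgt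
      · exact absurd (hj j hlt) h4
      · exact heq
      · exact absurd (h3 _ hgt) hj'
    subst ej
    rw [← hb]
    exact h5
  · intro h5
    exact ⟨v.1, by omega, v.2, by omega, hi, hi', hj, hj', by rw [hb]; exact h5⟩

theorem cnfState_succ {b : Bool} {s : ℕ} (h : (w 2).drop p = b :: rest)
    (hs : cnfState w B p = s) : cnfState w B (p + 1) = cnfStep s (b = true) (LitTrue w B p) := by
  rw [cnfState, hs, propext (bit_of_drop (a := []) (q := p) h rfl)]

theorem cnfState_unary {k s s' : ℕ} (h : (w 2).drop p = encodeUnary k ++ rest)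
    (hs : cnfState w B p = s) (h1 : ∀ l, cnfStep s True l = s) (h0 : ∀ l, cnfStep s False l = s') :
    cnfState w B (p + (encodeUnary k).length) = s' := by
  induction k generalizing p with
  | zero =>
    have := cnfState_succ (b := false) (rest := rest) (by simpa [encodeUnary] using h) hs
    simp only [Bool.false_eq_true, h0] at this
    exact this
  | succ k ih =>
    have hd : (w 2).drop p = true :: (encodeUnary k ++ rest) := by
      simpa [encodeUnary, List.replicate_succ] using h
    have := cnfState_succ hd hs
    simp only [h1] at this
    have h2 := ih (p := p + 1) (drop_of_drop (a := [true]) hd) this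
    have e : p + (encodeUnary (k + 1)).length = p + 1 + (encodeUnary k).length := by
      simp [encodeUnary]
      omega
    rw [e]
    exact h2

theorem cnfState_fail {q : ℕ} (hs : cnfState w B p = 2) (hq : p ≤ q) : cnfState w B q = 2 := by
  induction q, hq using Nat.le_induction with
  | base => exact hs
  | succ q _ ih => simp [cnfState, ih, cnfStep]

-- The truth value is consulted at the sign only. The two unary numbers are then skipped, and the
-- parity of the state remembers whether the clause is satisfied, with even for yes.
open Classical in
theorem cnfState_literal {n m : ℕ} (l : Literal (Fin n × Fin m)) {c : Prop} [Decidable c]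
    (h : (w 2).drop p = l.2 :: (encodeVar l.1 ++ rest))
    (hs : cnfState w B p = if c then 6 else 5) :
    cnfState w B (p + (l.2 :: encodeVar l.1).length) =
      if c ∨ (B l.1.1 l.1.2 ↔ l.2 = true) then 4 else 3 := by
  have h1 := cnfState_succ h hs
  have h2 : cnfState w B (p + 1) = if c ∨ (B l.1.1 l.1.2 ↔ l.2 = true) then 8 else 7 := by
    rw [h1, litTrue_iff l.1 l.2 h]
    by_cases hc : c
    · simp [hc, cnfStep]
    · simp [hc, cnfStep]
  have hd := drop_of_drop (a := [l.2]) h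
  have e : p + (l.2 :: encodeVar l.1).length =
      p + 1 + (encodeUnary l.1.1).length + (encodeUnary l.1.2).length := by
    simp [encodeVar]
    omega
  rw [e]
  replace hd : (w 2).drop (p + 1) = encodeUnary l.1.1 ++ (encodeUnary l.1.2 ++ rest) := by
    simpa [encodeVar] using hd
  have hd' := drop_of_drop hd
  split_ifs at h2 ⊢
  · exact cnfState_unary hd' (cnfState_unary (s' := 10) hd h2 (by simp [cnfStep])
      (by simp [cnfStep])) (by simp [cnfStep]) (by simp [cnfStep])
  · exact cnfState_unary hd' (cnfState_unary (s' := 9) hd h2 (by simp [cnfStep])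
      (by simp [cnfStep])) (by simp [cnfStep]) (by simp [cnfStep])

-- The proposition `c` records whether an earlier literal of the clause was true; it varies along
-- the induction.
open Classical in
theorem cnfState_clause {n m : ℕ} (D : Clause (Fin n × Fin m)) {c : Prop} [Decidable c]
    (h : (w 2).drop p = encodeList (fun l => l.2 :: encodeVar l.1) D ++ rest)
    (hs : cnfState w B p = if c then 4 else 3) :
    cnfState w B (p + (encodeList (fun l => l.2 :: encodeVar l.1) D).length) =
      if c ∨ ∃ l ∈ D, (B l.1.1 l.1.2 ↔ l.2 = true) then 0 else 2 := by
  induction D generalizing p c with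
  | nil =>
    have h1 := cnfState_succ (b := false) (rest := rest) (by simpa [encodeList] using h) hs
    simp only [encodeList, List.flatMap_nil, List.nil_append, List.length_singleton, h1]
    by_cases hc : c <;> simp [hc, cnfStep]
  | cons l D ih =>
    have e : encodeList (fun l : Literal (Fin n × Fin m) => l.2 :: encodeVar l.1) (l :: D) =
        true :: (l.2 :: encodeVar l.1) ++
          encodeList (fun l : Literal (Fin n × Fin m) => l.2 :: encodeVar l.1) D := by
      simp [encodeList]
    rw [e] at h ⊢
    have h1 := cnfState_succ (b := true) (rest := l.2 :: (encodeVar l.1 ++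
      (encodeList (fun l : Literal (Fin n × Fin m) => l.2 :: encodeVar l.1) D ++ rest)))
      (by simpa using h) hs
    have h2 : cnfState w B (p + 1) = if c then 6 else 5 := by
      rw [h1]
      by_cases hc : c <;> simp [hc, cnfStep]
    have hd := drop_of_drop (a := [true]) (p := p) (l := w 2) (by simpa using h)
    have h3 := cnfState_literal l hd h2
    have hd' := drop_of_drop (a := true :: (l.2 :: encodeVar l.1)) (p := p) (l := w 2)
      (by rw [← List.append_assoc]; exact h)
    have e2 : p + [true].length + (l.2 :: encodeVar l.1).length =
        p + (true :: (l.2 :: encodeVar l.1)).length := by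
      simp
      omega
    rw [e2] at h3
    have h4 := ih hd' h3
    rw [List.length_append, ← add_assoc, h4]
    simp only [List.mem_cons, exists_eq_or_imp, or_assoc]

open Classical in
theorem cnfState_cnf {n m : ℕ} (ψ : CNF (Fin n × Fin m))
    (h : (w 2).drop p = encodeCNF ψ ++ rest) (hs : cnfState w B p = 0) :
    cnfState w B (p + (encodeCNF ψ).length) =
      if ∀ D ∈ ψ, ∃ l ∈ D, (B l.1.1 l.1.2 ↔ l.2 = true) then 1 else 2 := by
  induction ψ generalizing p with
  | nil =>
    have h1 := cnfState_succ (b := false) (rest := rest)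
      (by simpa [encodeCNF, encodeList] using h) hs
    simp [encodeCNF, encodeList, h1, cnfStep]
  | cons D ψ ih =>
    have e : encodeCNF (D :: ψ) = true :: encodeList (fun l => l.2 :: encodeVar l.1) D ++
        encodeCNF ψ := by
      simp [encodeCNF, encodeList]
    rw [e] at h ⊢
    have h1 := cnfState_succ (b := true) (rest := encodeList (fun l => l.2 :: encodeVar l.1) D ++
      (encodeCNF ψ ++ rest)) (by simpa using h) hs
    -- A new clause starts unsatisfied, so `cnfState_clause` applies with `c := False`.
    have h2 : cnfState w B (p + 1) = if False then 4 else 3 := by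
      rw [h1]
      simp [cnfStep]
    have hd := drop_of_drop (a := [true]) (p := p) (l := w 2) (by simpa using h)
    have h3 := cnfState_clause D hd h2
    have hd' := drop_of_drop hd
    simp only [false_or] at h3
    have e2 : p + (true :: encodeList (fun l : Literal (Fin n × Fin m) => l.2 :: encodeVar l.1) D ++
        encodeCNF ψ).length = p + [true].length +
        (encodeList (fun l : Literal (Fin n × Fin m) => l.2 :: encodeVar l.1) D).length +
        (encodeCNF ψ).length := by
      simp
      omega
    rw [e2]
    simp only [List.forall_mem_cons]
    split_ifs at h3 with hD
    · rw [ih hd' h3]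
      simp only [hD, true_and]
    · rw [cnfState_fail h3 (Nat.le_add_right _ _), if_neg fun h => hD h.1]

theorem cnfTrue_iff {n m : ℕ} (ψ : CNF (Fin n × Fin m)) (θ : Fin n × Fin m → Bool)
    (hw : w 2 = encodeCNF ψ) (hB : ∀ v : Fin n × Fin m, B v.1 v.2 ↔ θ v = true) :
    CnfTrue w B ↔ ψ.IsSatisfiedBy θ := by
  have h := cnfState_cnf (w := w) (B := B) (p := 0) (rest := []) ψ (by simpa using hw) rfl
  have e : (∀ D ∈ ψ, ∃ l ∈ D, (B l.1.1 l.1.2 ↔ l.2 = true)) ↔ ψ.IsSatisfiedBy θ := by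
    refine forall₂_congr fun D _ => exists_congr fun l => and_congr_right fun _ => ?_
    rw [hB]
    exact Bool.eq_iff_iff.symm
  rw [CnfTrue, hw, ← Nat.zero_add (encodeCNF ψ).length, h, ← e]
  split_ifs with h'
  · simpa using h'
  · simpa using h'

end

/-! ### Incidence matrices -/

section Incidence

variable {n m : ℕ}

theorem mem_orbit_iff {θ τ : Fin n × Fin m → Bool} :
    τ ∈ assignmentOrbit (rowColumnGroup n m) θ ↔
      ∃ (σ : Equiv.Perm (Fin n)) (π : Equiv.Perm (Fin m)), ∀ r c, τ (r, c) = θ (σ r, π c) := by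
  constructor
  · rintro ⟨g, ⟨σ, π, rfl⟩, rfl⟩
    exact ⟨σ⁻¹, π⁻¹, fun r c => rfl⟩
  · rintro ⟨σ, π, h⟩
    refine ⟨Equiv.prodCongr σ⁻¹ π⁻¹, ⟨σ⁻¹, π⁻¹, rfl⟩, ?_⟩
    funext ⟨r, c⟩
    exact h r c

theorem mem_orbit_trans {θ τ ρ : Fin n × Fin m → Bool}
    (h : τ ∈ assignmentOrbit (rowColumnGroup n m) θ)
    (h' : ρ ∈ assignmentOrbit (rowColumnGroup n m) τ) :
    ρ ∈ assignmentOrbit (rowColumnGroup n m) θ := by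
  rw [mem_orbit_iff] at *
  obtain ⟨σ, π, h⟩ := h
  obtain ⟨σ', π', h'⟩ := h'
  exact ⟨σ * σ', π * π', fun r c => (h' r c).trans (h _ _)⟩

theorem mem_orbit_symm {θ τ : Fin n × Fin m → Bool}
    (h : τ ∈ assignmentOrbit (rowColumnGroup n m) θ) :
    θ ∈ assignmentOrbit (rowColumnGroup n m) τ := by
  rw [mem_orbit_iff] at *
  obtain ⟨σ, π, h⟩ := h
  exact ⟨σ⁻¹, π⁻¹, fun r c => by rw [h]; simp⟩

/-- A complete symmetry breaking predicate has only one satisfying assignment in each orbit. -/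
theorem IsCompleteSBP.eq_of_isSatisfiedBy {Ω : Type} {G : Subgroup (Equiv.Perm Ω)} {ψ : CNF Ω}
    (h : IsCompleteSBP G ψ) {θ τ τ' : Ω → Bool} (hτ : τ ∈ assignmentOrbit G θ)
    (hτ' : τ' ∈ assignmentOrbit G θ) (hs : ψ.IsSatisfiedBy τ) (hs' : ψ.IsSatisfiedBy τ') :
    τ = τ' := by
  obtain ⟨ρ, -, -, hρ⟩ := h θ
  have key : ∀ τ ∈ assignmentOrbit G θ, ψ.IsSatisfiedBy τ → ρ = τ := by
    intro τ hτ hs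
    by_contra hne
    obtain ⟨D, hD, hD'⟩ := hρ τ hτ hne
    obtain ⟨l, hl, hl'⟩ := hs D hD
    exact hD' l hl hl'
  rw [← key τ hτ hs, key τ' hτ' hs']

open Classical in
/-- The incidence matrix of a graph, with a column for each pair of vertices; the columns of pairs
that are not adjacent vanish. -/
noncomputable def incidence (G : SimpleGraph (Fin n)) (p : Fin n × Fin (n * n)) : Bool :=
  decide (G.Adj (finProdFinEquiv.symm p.2).1 (finProdFinEquiv.symm p.2).2 ∧
    (p.1 = (finProdFinEquiv.symm p.2).1 ∨ p.1 = (finProdFinEquiv.symm p.2).2))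

theorem incidence_eq_true {G : SimpleGraph (Fin n)} {v i j : Fin n} :
    incidence G (v, finProdFinEquiv (i, j)) = true ↔ G.Adj i j ∧ (v = i ∨ v = j) := by
  simp [incidence]

/-- The column of the edge `ij` has ones exactly in rows `i` and `j`. Its image under `π` is a
nonzero column of `G`, hence that of an edge, with ones in the distinct rows `σ i` and `σ j`; these
must be the ends of that edge. -/
theorem adj_of_incidence_eq {G H : SimpleGraph (Fin n)} {σ : Equiv.Perm (Fin n)}
    {π : Equiv.Perm (Fin (n * n))} (h : ∀ r c, incidence H (r, c) = incidence G (σ r, π c))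
    {i j : Fin n} (hij : H.Adj i j) : G.Adj (σ i) (σ j) := by
  obtain ⟨⟨i', j'⟩, hπ⟩ := finProdFinEquiv.surjective (π (finProdFinEquiv (i, j)))
  have key : ∀ v, H.Adj i j ∧ (v = i ∨ v = j) ↔ G.Adj i' j' ∧ (σ v = i' ∨ σ v = j') := by
    intro v
    rw [← incidence_eq_true, h, ← hπ, incidence_eq_true]
  have h1 := (key i).1 ⟨hij, .inl rfl⟩
  have h2 := (key j).1 ⟨hij, .inr rfl⟩
  have hne : σ i ≠ σ j := fun h => hij.ne (σ.injective h)
  rcases h1.2 with e | e <;> rcases h2.2 with e' | e'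
  · exact absurd (e.trans e'.symm) hne
  · rw [e, e']
    exact h1.1
  · rw [e, e']
    exact h1.1.symm
  · exact absurd (e.trans e'.symm) hne

/-- Two graphs are isomorphic if and only if their incidence matrices are equal up to permutations
of the rows and the columns. -/
theorem incidence_mem_orbit_iff {G H : SimpleGraph (Fin n)} :
    incidence H ∈ assignmentOrbit (rowColumnGroup n (n * n)) (incidence G) ↔
      Nonempty (G ≃g H) := by
  rw [mem_orbit_iff]
  constructor
  · rintro ⟨σ, π, h⟩
    refine ⟨⟨σ.symm, fun {i j} => ⟨fun hH => ?_, fun hG => ?_⟩⟩⟩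
    · simpa using adj_of_incidence_eq h hH
    · have h' : ∀ r c, incidence G (r, c) = incidence H (σ.symm r, π.symm c) := by
        intro r c
        rw [h]
        simp
      exact adj_of_incidence_eq h' hG
  · rintro ⟨f⟩
    -- Columns are permuted by the action of the vertex bijection on ordered pairs.
    refine ⟨f.symm.toEquiv, finProdFinEquiv.symm.trans
      ((Equiv.prodCongr f.symm.toEquiv f.symm.toEquiv).trans finProdFinEquiv), fun r c => ?_⟩
    obtain ⟨⟨i, j⟩, rfl⟩ := finProdFinEquiv.surjective c
    rw [Bool.eq_iff_iff, incidence_eq_true]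
    simp only [Equiv.trans_apply, Equiv.symm_apply_apply, Equiv.prodCongr_apply, Prod.map_apply,
      incidence_eq_true]
    have h1 : G.Adj (f.symm i) (f.symm j) ↔ H.Adj i j := f.symm.map_rel_iff
    change _ ↔ G.Adj (f.symm i) (f.symm j) ∧ (f.symm r = f.symm i ∨ f.symm r = f.symm j)
    rw [h1, f.symm.injective.eq_iff, f.symm.injective.eq_iff]

end Incidence

/-! ### Codes of graphs -/

theorem eq_of_bit {l l' : List Bool} (h : l.length = l'.length)
    (hb : ∀ k < l.length, (Bit l k ↔ Bit l' k)) : l = l' := by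
  refine List.ext_getElem h fun k h1 h2 => ?_
  have := hb k h1
  rw [Bit, Bit, List.getD_eq_getElem _ _ h1, List.getD_eq_getElem _ _ h2] at this
  exact Bool.eq_iff_iff.2 this

theorem bit_append_left {l l' : List Bool} {k : ℕ} (h : k < l.length) :
    Bit (l ++ l') k ↔ Bit l k := by
  rw [Bit, Bit, List.getD_append _ _ _ _ h]

theorem bit_append_right {l l' : List Bool} {k : ℕ} : Bit (l ++ l') (l.length + k) ↔ Bit l' k := by
  rw [Bit, Bit, List.getD_append_right _ _ _ _ (Nat.le_add_right _ _), Nat.add_sub_cancel_left]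

theorem length_flatMap_const {α β : Type} (l : List α) (f : α → List β) {m : ℕ}
    (hf : ∀ a, (f a).length = m) : (l.flatMap f).length = l.length * m := by
  simp [List.length_flatMap, hf]

theorem bit_flatMap {α : Type} (l : List α) (f : α → List Bool) {m : ℕ}
    (hf : ∀ a, (f a).length = m) {i j : ℕ} (hi : i < l.length) (hj : j < m) :
    Bit (l.flatMap f) (i * m + j) ↔ Bit (f l[i]) j := by
  induction l generalizing i with
  | nil => simp at hi
  | cons a l ih =>
    rw [List.flatMap_cons]
    cases i with
    | zero =>
      rw [Nat.zero_mul, Nat.zero_add, bit_append_left (by rw [hf]; exact hj)]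
      rfl
    | succ i =>
      have e : (i + 1) * m + j = (f a).length + (i * m + j) := by
        rw [hf]
        ring
      rw [e, bit_append_right, ih (by simpa using hi)]
      rfl

section Codes

variable {n : ℕ}

theorem length_encodeGraph (G : SimpleGraph (Fin n)) :
    (encodeGraph G).length = n + 1 + n * n := by
  simp only [encodeGraph, List.length_append]
  rw [length_flatMap_const (m := n) _ _ (by simp)]
  simp [encodeUnary]

theorem bit_encodeGraph_lt (G : SimpleGraph (Fin n)) {k : ℕ} (hk : k < n) :
    Bit (encodeGraph G) k := by
  rw [encodeGraph, bit_append_left (by simp [encodeUnary]; omega), encodeUnary,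
    bit_append_left (by simpa using hk)]
  simp [Bit, hk]

theorem not_bit_encodeGraph (G : SimpleGraph (Fin n)) : ¬Bit (encodeGraph G) n := by
  rw [encodeGraph, bit_append_left (by simp [encodeUnary]), encodeUnary]
  simp [Bit]

theorem bit_encodeGraph_adj (G : SimpleGraph (Fin n)) (i j : Fin n) :
    Bit (encodeGraph G) (n + 1 + (i * n + j)) ↔ G.Adj i j := by
  have e : n + 1 = (encodeUnary n).length := by simp [encodeUnary]
  rw [encodeGraph, e, bit_append_right, bit_flatMap (m := n) _ _ (by simp) (by simp) j.2]
  simp [Bit]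

variable {w : Fin 3 → List Bool}

/-- The code length `k + 1 + k * k` increases strictly with `k`, so the sum counts exactly the `k`
below `n`. -/
theorem order_eq (hw : (w 0).length = 2 * (n + 1 + n * n)) : order w = n := by
  rw [order, hw]
  have h : ∀ k, ind (2 * (k + 1 + k * k) < 2 * (n + 1 + n * n)) = if k < n then 1 else 0 := by
    intro k
    split_ifs with hk
    · exact ind_true (by nlinarith)
    · exact ind_false (by nlinarith)
  simp only [h, Finset.sum_ite, Finset.sum_const_zero, add_zero, Finset.sum_const, smul_eq_mul,
    mul_one]
  have e : {x ∈ Finset.range (2 * (n + 1 + n * n)) | x < n} = Finset.range n := by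
    ext k
    simp only [Finset.mem_filter, Finset.mem_range, and_iff_right_iff_imp]
    intro hk
    omega
  rw [e, Finset.card_range]

theorem bit_pair {G H : SimpleGraph (Fin n)} (hw : w 0 = encodeGraph G ++ encodeGraph H)
    {g k : ℕ} (hg : g < 2) (hk : k < n + 1 + n * n) :
    Bit (w 0) (g * (n + 1 + n * n) + k) ↔ Bit (encodeGraph (if g = 0 then G else H)) k := by
  rw [hw]
  obtain rfl | rfl : g = 0 ∨ g = 1 := by omega
  · rw [Nat.zero_mul, Nat.zero_add, bit_append_left (by rwa [length_encodeGraph]), if_pos rfl]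
  · rw [Nat.one_mul, ← length_encodeGraph G, bit_append_right, if_neg one_ne_zero]

theorem index_lt (i j : Fin n) : (i * n + j : ℕ) < n * n := by
  have h1 : (i : ℕ) * n + n ≤ n * n := by
    rw [← Nat.succ_mul]
    exact Nat.mul_le_mul_right n i.2
  have := j.2
  omega

theorem order_eq_of_pair {G H : SimpleGraph (Fin n)} (hw : w 0 = encodeGraph G ++ encodeGraph H) :
    order w = n :=
  order_eq (by rw [hw, List.length_append, length_encodeGraph, length_encodeGraph]; ring)

theorem codeLength_eq_of_pair {G H : SimpleGraph (Fin n)}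
    (hw : w 0 = encodeGraph G ++ encodeGraph H) : codeLength w = n + 1 + n * n := by
  rw [codeLength, order_eq_of_pair hw]

theorem adjBit_iff {G H : SimpleGraph (Fin n)} (hw : w 0 = encodeGraph G ++ encodeGraph H) {g : ℕ}
    (hg : g < 2) (i j : Fin n) : AdjBit w g i j ↔ (if g = 0 then G else H).Adj i j := by
  rw [AdjBit, codeLength_eq_of_pair hw, order_eq_of_pair hw, add_assoc,
    bit_pair hw hg (by have := index_lt i j; omega), bit_encodeGraph_adj]

theorem isGraphPair_of_eq {G H : SimpleGraph (Fin n)} (hw : w 0 = encodeGraph G ++ encodeGraph H) :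
    IsGraphPair w := by
  have hq := codeLength_eq_of_pair hw
  have hn := order_eq_of_pair hw
  refine ⟨by rw [hw, hq, List.length_append, length_encodeGraph, length_encodeGraph]; ring,
    fun g hg => ⟨fun i hi => ?_, ?_, fun i hi => ⟨?_, fun j hj => ?_⟩⟩⟩
  · rw [hq, bit_pair hw hg (by omega)]
    exact bit_encodeGraph_lt _ (by omega)
  · rw [hq, hn, bit_pair hw hg (by omega)]
    exact not_bit_encodeGraph _
  · rw [adjBit_iff hw hg ⟨i, hn ▸ hi⟩ ⟨i, hn ▸ hi⟩]
    exact SimpleGraph.irrefl _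
  · rw [adjBit_iff hw hg ⟨i, hn ▸ hi⟩ ⟨j, hn ▸ hj⟩, adjBit_iff hw hg ⟨j, hn ▸ hj⟩ ⟨i, hn ▸ hi⟩]
    exact fun h => h.symm

/-- The graphs are read off from the matrix bits, symmetric and loopless by assumption; their codes
then agree with the word letter by letter. -/
theorem exists_of_isGraphPair (hn : order w = n) (h : IsGraphPair w) :
    ∃ G H : SimpleGraph (Fin n), w 0 = encodeGraph G ++ encodeGraph H := by
  obtain ⟨hl, h⟩ := h
  have hq : codeLength w = n + 1 + n * n := by rw [codeLength, hn]
  let K : (g : ℕ) → g < 2 → SimpleGraph (Fin n) := fun g hg =>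
    { Adj := fun i j => AdjBit w g i j
      symm := ⟨fun i j hij => ((h g hg).2.2 i (hn ▸ i.2)).2 j (hn ▸ j.2) hij⟩
      loopless := ⟨fun i hi => ((h g hg).2.2 i (hn ▸ i.2)).1 hi⟩ }
  have hK : ∀ g (hg : g < 2), ∀ k < n + 1 + n * n,
      (Bit (w 0) (g * (n + 1 + n * n) + k) ↔ Bit (encodeGraph (K g hg)) k) := by
    intro g hg k hk
    rcases lt_trichotomy k n with hkn | rfl | hkn
    · have := (h g hg).1 k (hn ▸ hkn)
      rw [hq] at this
      exact iff_of_true this (bit_encodeGraph_lt _ hkn)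
    · have := (h g hg).2.1
      rw [hq, hn] at this
      exact iff_of_false this (not_bit_encodeGraph _)
    -- Positions behind the unary header belong to the matrix; division by `n` recovers row and
    -- column.
    · obtain ⟨t, rfl⟩ : ∃ t, k = n + 1 + t := ⟨k - (n + 1), by omega⟩
      have ht : t < n * n := by omega
      have hn0 : 0 < n := Nat.pos_of_ne_zero fun h0 => by simp [h0] at ht
      have e : t = (⟨t / n, Nat.div_lt_of_lt_mul ht⟩ : Fin n) * n +
          (⟨t % n, Nat.mod_lt _ hn0⟩ : Fin n) := (Nat.div_add_mod' t n).symm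
      rw [e, bit_encodeGraph_adj]
      change _ ↔ AdjBit w g _ _
      simp only [AdjBit, hq, hn, add_assoc]
  refine ⟨K 0 two_pos, K 1 one_lt_two, eq_of_bit ?_ fun k hk => ?_⟩
  · rw [hl, hq, List.length_append, length_encodeGraph, length_encodeGraph]
    ring
  · rw [hl, hq] at hk
    rcases Nat.lt_or_ge k (n + 1 + n * n) with hk' | hk'
    · rw [bit_append_left (by rwa [length_encodeGraph]), ← hK 0 two_pos k hk']
      simp
    · obtain ⟨t, rfl⟩ := Nat.exists_eq_add_of_le hk'
      have := hK 1 one_lt_two t (by omega)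
      rw [Nat.one_mul] at this
      rw [this, ← length_encodeGraph (K 0 two_pos), bit_append_right]

end Codes

/-! ### Certificates -/

section Certificates

variable {n : ℕ} {w : Fin 3 → List Bool}

/-- Relation number `t` of the certificate is the graph of the permutation `σ`. -/
def CertIs (w : Fin 3 → List Bool) (t : ℕ) {N : ℕ} (σ : Equiv.Perm (Fin N)) : Prop :=
  ∀ a b : Fin N, CertRel w t a b ↔ σ a = b

/-- The equivalence `a = a' ↔ b = b'` makes the relation single-valued and injective at once;
together with totality on a finite set this gives a bijection. -/
theorem certPerm_iff {t N : ℕ} : CertPerm w t N ↔ ∃ σ : Equiv.Perm (Fin N), CertIs w t σ := by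
  constructor
  · rintro ⟨h1, h2⟩
    have h3 : ∀ a : Fin N, ∃ b : Fin N, CertRel w t a b := fun a =>
      let ⟨b, hb, h⟩ := h1 a a.2
      ⟨⟨b, hb⟩, h⟩
    choose f hf using h3
    have hinj : Injective f := fun a a' haa => Fin.ext
      ((h2 a a.2 (f a) (f a).2 a' a'.2 (f a') (f a').2 (hf a) (hf a')).2 (congrArg _ haa))
    refine ⟨Equiv.ofBijective f (Finite.injective_iff_bijective.1 hinj), fun a b => ⟨fun h => ?_,
      fun h => ?_⟩⟩
    · exact Fin.ext ((h2 a a.2 (f a) (f a).2 a a.2 b b.2 (hf a) h).1 rfl)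
    · rw [← h]
      exact hf a
  · rintro ⟨σ, hσ⟩
    refine ⟨fun a ha => ⟨σ ⟨a, ha⟩, (σ _).2, (hσ ⟨a, ha⟩ _).2 rfl⟩,
      fun a ha b hb a' ha' b' hb' h h' => ?_⟩
    have e := (hσ ⟨a, ha⟩ ⟨b, hb⟩).1 h
    have e' := (hσ ⟨a', ha'⟩ ⟨b', hb'⟩).1 h'
    have := σ.injective.eq_iff (a := ⟨a, ha⟩) (b := ⟨a', ha'⟩)
    rw [e, e'] at this
    simpa using this.symm

/-- The certificate forces `v` to be `σ r` and the pair `(i, j)` to be the one numbered `π e`. -/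
theorem certMatrix_iff {G H : SimpleGraph (Fin n)} (hw : w 0 = encodeGraph G ++ encodeGraph H)
    {g : ℕ} (hg : g < 2) {σ : Equiv.Perm (Fin n)} {π : Equiv.Perm (Fin (n * n))}
    (hσ : CertIs w (2 * g) σ) (hπ : CertIs w (2 * g + 1) π) (r : Fin n) (e : Fin (n * n)) :
    CertMatrix w g r e ↔ incidence (if g = 0 then G else H) (σ r, π e) = true := by
  have hn := order_eq_of_pair hw
  obtain ⟨⟨i, j⟩, hij⟩ := finProdFinEquiv.surjective (π e)
  have hval : ∀ i j : Fin n, ((finProdFinEquiv (i, j) : Fin (n * n)) : ℕ) = i * n + j := by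
    intro i j
    rw [finProdFinEquiv_apply_val]
    ring
  rw [← hij, incidence_eq_true]
  constructor
  · rintro ⟨v, hv, i', hi', j', hj', h1, h2, h3, h4⟩
    rw [hn] at hv hi' hj' h2
    have e1 := (hσ r ⟨v, hv⟩).1 h1
    have e2 : π e = finProdFinEquiv (⟨i', hi'⟩, ⟨j', hj'⟩) :=
      (hπ e _).1 (by rw [hval]; exact h2)
    rw [← hij, finProdFinEquiv.injective.eq_iff, Prod.mk.injEq] at e2
    rw [e1, e2.1, e2.2]
    exact ⟨(adjBit_iff hw hg ⟨i', hi'⟩ ⟨j', hj'⟩).1 h3,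
      h4.imp (fun h => Fin.ext h) fun h => Fin.ext h⟩
  · rintro ⟨h1, h2⟩
    refine ⟨σ r, hn ▸ (σ r).2, i, hn ▸ i.2, j, hn ▸ j.2, (hσ r _).2 rfl, ?_,
      (adjBit_iff hw hg i j).2 h1, h2.imp (congrArg _) (congrArg _)⟩
    have := (hπ e (π e)).2 rfl
    rw [← hij, hval] at this
    rw [hn]
    exact this

open Classical in
/-- The word that encodes four relations on the numbers below `N`. -/
noncomputable def certificate (N : ℕ) (R : ℕ → ℕ → ℕ → Prop) : List Bool :=
  (List.range (4 * (N * N))).map fun p => decide (R (p % 4) (p / 4 / N) (p / 4 % N))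

/-- The four relations are interleaved: the remainder modulo `4` selects the relation, the quotient
the pair. -/
theorem bit_certificate {N t a b : ℕ} {R : ℕ → ℕ → ℕ → Prop} (ht : t < 4) (ha : a < N)
    (hb : b < N) : Bit (certificate N R) (4 * (a * N + b) + t) ↔ R t a b := by
  have h1 : a * N + b < N * N := by
    have : (a + 1) * N ≤ N * N := Nat.mul_le_mul_right N ha
    rw [Nat.succ_mul] at this
    omega
  have h2 : (4 * (a * N + b) + t) % 4 = t := by omega
  have h3 : (4 * (a * N + b) + t) / 4 = a * N + b := by omega
  have h4 : (a * N + b) / N = a := by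
    rw [Nat.add_comm, Nat.add_mul_div_right _ _ (by omega), Nat.div_eq_of_lt hb, Nat.zero_add]
  have h5 : (a * N + b) % N = b := by
    rw [Nat.add_comm, Nat.add_mul_mod_self_right, Nat.mod_eq_of_lt hb]
  rw [Bit, certificate, List.getD_eq_getElem _ _ (by simp; omega)]
  simp [h2, h3, h4, h5]

/-- The graph of a permutation as a relation of numbers. -/
def permRel {N : ℕ} (σ : Equiv.Perm (Fin N)) (a b : ℕ) : Prop := ∃ h : a < N, (σ ⟨a, h⟩ : ℕ) = b

theorem certIs_certificate {N t : ℕ} {R : ℕ → ℕ → ℕ → Prop} {σ : Equiv.Perm (Fin N)}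
    (hw : w 1 = certificate (order w * order w) R) (ht : t < 4) (hN : N ≤ order w * order w)
    (hR : R t = permRel σ) : CertIs w t σ := by
  intro a b
  rw [CertRel, hw, bit_certificate ht (a.2.trans_le hN) (b.2.trans_le hN), hR]
  exact ⟨fun ⟨_, h⟩ => Fin.ext h, fun h => ⟨a.2, congrArg _ h⟩⟩

/-- The condition checked by the verifier, for the code of a pair of graphs. -/
theorem accept_iff {G H : SimpleGraph (Fin n)} {ψ : CNF (Fin n × Fin (n * n))} (hn : 0 < n)
    (hw : w 0 = encodeGraph G ++ encodeGraph H) (hψ : w 2 = encodeCNF ψ) :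
    Accept w ↔ ∃ (σ σ' : Equiv.Perm (Fin n)) (π π' : Equiv.Perm (Fin (n * n))),
      CertIs w 0 σ ∧ CertIs w 1 π ∧ CertIs w 2 σ' ∧ CertIs w 3 π' ∧
      (fun p : Fin n × Fin (n * n) => incidence G (σ p.1, π p.2)) ≠
        (fun p : Fin n × Fin (n * n) => incidence H (σ' p.1, π' p.2)) ∧
      ψ.IsSatisfiedBy (fun p => incidence G (σ p.1, π p.2)) ∧
      ψ.IsSatisfiedBy (fun p => incidence H (σ' p.1, π' p.2)) := by
  have ho := order_eq_of_pair hw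
  have hmat : ∀ {σ σ' : Equiv.Perm (Fin n)} {π π' : Equiv.Perm (Fin (n * n))},
      CertIs w 0 σ → CertIs w 1 π → CertIs w 2 σ' → CertIs w 3 π' →
      ((∃ r < order w, ∃ e < order w * order w, ¬(CertMatrix w 0 r e ↔ CertMatrix w 1 r e)) ∧
        CnfTrue w (CertMatrix w 0) ∧ CnfTrue w (CertMatrix w 1) ↔
      (fun p : Fin n × Fin (n * n) => incidence G (σ p.1, π p.2)) ≠
        (fun p : Fin n × Fin (n * n) => incidence H (σ' p.1, π' p.2)) ∧
      ψ.IsSatisfiedBy (fun p => incidence G (σ p.1, π p.2)) ∧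
      ψ.IsSatisfiedBy (fun p => incidence H (σ' p.1, π' p.2))) := by
    intro σ σ' π π' h0 h1 h2 h3
    have m0 : ∀ (r : Fin n) (e : Fin (n * n)), CertMatrix w 0 r e ↔ incidence G (σ r, π e) = true :=
      certMatrix_iff hw two_pos h0 h1
    have m1 : ∀ (r : Fin n) (e : Fin (n * n)), CertMatrix w 1 r e ↔ incidence H (σ' r, π' e) = true :=
      certMatrix_iff hw one_lt_two h2 h3
    rw [cnfTrue_iff ψ (fun p => incidence G (σ p.1, π p.2)) hψ fun v => m0 v.1 v.2,
      cnfTrue_iff ψ (fun p => incidence H (σ' p.1, π' p.2)) hψ fun v => m1 v.1 v.2]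
    refine and_congr ?_ Iff.rfl
    rw [Function.ne_iff, ho]
    constructor
    · rintro ⟨r, hr, e, he, h⟩
      refine ⟨(⟨r, hr⟩, ⟨e, he⟩), fun heq => h ?_⟩
      rw [m0 ⟨r, hr⟩ ⟨e, he⟩, m1 ⟨r, hr⟩ ⟨e, he⟩]
      exact Bool.eq_iff_iff.1 heq
    · rintro ⟨⟨r, e⟩, h⟩
      refine ⟨r, r.2, e, e.2, fun heq => h ?_⟩
      rw [m0, m1] at heq
      exact Bool.eq_iff_iff.2 heq
  rw [Accept, or_iff_right (not_not_intro (isGraphPair_of_eq hw)), and_iff_right (ho ▸ hn)]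
  constructor
  · rintro ⟨⟨p0, p1⟩, ⟨p2, p3⟩, h⟩
    rw [ho] at p0 p1 p2 p3
    obtain ⟨σ, h0⟩ := certPerm_iff.1 p0
    obtain ⟨π, h1⟩ := certPerm_iff.1 p1
    obtain ⟨σ', h2⟩ := certPerm_iff.1 p2
    obtain ⟨π', h3⟩ := certPerm_iff.1 p3
    exact ⟨σ, σ', π, π', h0, h1, h2, h3, (hmat h0 h1 h2 h3).1 h⟩
  · rintro ⟨σ, σ', π, π', h0, h1, h2, h3, h⟩
    refine ⟨⟨?_, ?_⟩, ⟨?_, ?_⟩, (hmat h0 h1 h2 h3).2 h⟩ <;> rw [ho, certPerm_iff]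
    exacts [⟨σ, h0⟩, ⟨π, h1⟩, ⟨σ', h2⟩, ⟨π', h3⟩]

end Certificates

/-! ### Soundness and completeness of the verifier -/

section Verifier

variable {n : ℕ} {ψ : CNF (Fin n × Fin (n * n))}

theorem not_accept_of_iso (hψ : IsCompleteSBP (rowColumnGroup n (n * n)) ψ) (hn : 0 < n)
    {w : Fin 3 → List Bool} {G H : SimpleGraph (Fin n)} (hiso : Nonempty (G ≃g H))
    (hw : w 0 = encodeGraph G ++ encodeGraph H) (hw2 : w 2 = encodeCNF ψ) : ¬Accept w := by
  rw [accept_iff hn hw hw2]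
  rintro ⟨σ, σ', π, π', -, -, -, -, hne, hs, hs'⟩
  exact hne (hψ.eq_of_isSatisfiedBy (θ := incidence G)
    (mem_orbit_iff.2 ⟨σ, π, fun _ _ => rfl⟩)
    (mem_orbit_trans (incidence_mem_orbit_iff.2 hiso)
      (mem_orbit_iff.2 ⟨σ', π', fun _ _ => rfl⟩)) hs hs')

theorem exists_accept_of_not_iso (hψ : IsCompleteSBP (rowColumnGroup n (n * n)) ψ) (hn : 0 < n)
    {x : List Bool} {G H : SimpleGraph (Fin n)} (hiso : ¬Nonempty (G ≃g H))
    (hx : x = encodeGraph G ++ encodeGraph H) :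
    ∃ c : List Bool, c.length = 4 * ((n * n) * (n * n)) ∧ Accept ![x, c, encodeCNF ψ] := by
  obtain ⟨τ, hτ, hs, -⟩ := hψ (incidence G)
  obtain ⟨τ', hτ', hs', -⟩ := hψ (incidence H)
  have hne : τ ≠ τ' := by
    rintro rfl
    exact hiso (incidence_mem_orbit_iff.1 (mem_orbit_trans hτ (mem_orbit_symm hτ')))
  obtain ⟨σ, π, hτ⟩ := mem_orbit_iff.1 hτ
  obtain ⟨σ', π', hτ'⟩ := mem_orbit_iff.1 hτ'
  obtain rfl : τ = fun p => incidence G (σ p.1, π p.2) := funext fun p => hτ p.1 p.2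
  obtain rfl : τ' = fun p => incidence H (σ' p.1, π' p.2) := funext fun p => hτ' p.1 p.2
  -- The numbering follows `CertMatrix`: relation `2 * g` permutes rows and `2 * g + 1` columns of
  -- graph `g`.
  let R : ℕ → ℕ → ℕ → Prop
    | 0 => permRel σ
    | 1 => permRel π
    | 2 => permRel σ'
    | _ => permRel π'
  refine ⟨certificate (n * n) R, by simp [certificate], ?_⟩
  rw [accept_iff hn hx rfl]
  have ho : order ![x, certificate (n * n) R, encodeCNF ψ] = n := order_eq_of_pair hx
  have hc : ![x, certificate (n * n) R, encodeCNF ψ] 1 =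
    certificate (order ![x, certificate (n * n) R, encodeCNF ψ] *
      order ![x, certificate (n * n) R, encodeCNF ψ]) R := by
    rw [ho]
    rfl
  -- All four relations share the range `n * n`, so the row permutations occupy only part of theirs.
  have hle : n ≤ n * n := Nat.le_mul_of_pos_left n hn
  exact ⟨σ, σ', π, π', certIs_certificate hc (by omega) (by rwa [ho]) rfl,
    certIs_certificate hc (by omega) (by rw [ho]) rfl,
    certIs_certificate hc (by omega) (by rwa [ho]) rfl,
    certIs_certificate hc (by omega) (by rw [ho]) rfl, hne, hs, hs'⟩

end Verifier

/-- The number of rows of the matrix for which the verifier asks for a symmetry breaking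
predicate. -/
noncomputable def rows (w : Fin 3 → List Bool) : ℕ+ := Nat.succPNat (order w - 1)

theorem rows_eq {w : Fin 3 → List Bool} (h : 0 < order w) : (rows w : ℕ) = order w := by
  rw [rows, Nat.succPNat_coe]
  omega

/-- If symmetry breaking predicates for row-column symmetry can be computed in polynomial time, then
graph isomorphism is in coNP. -/
theorem gi_mem_coNP (h : RowColumnSBPInPolyTime) : GI ∈ coNP := by
  classical
  obtain ⟨δ, hδ, ⟨D⟩⟩ := h
  -- The order is read from the input word alone, so the empty certificate here gives the same
  -- format as the actual one.
  let u : List Bool → List Bool := fun x =>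
    encodeCNF (δ (rows ![x, [], []]) (rows ![x, [], []] * rows ![x, [], []]))
  -- The value of the product in `ℕ+` is `n * n` only up to a propositional equality, along which
  -- the predicate is transported.
  have hcast : ∀ (n m : ℕ+) {k : ℕ}, (m : ℕ) = k → ∃ ψ : CNF (Fin n × Fin k),
      IsCompleteSBP (rowColumnGroup n k) ψ ∧ encodeCNF (δ n m) = encodeCNF ψ := by
    rintro n m _ rfl
    exact ⟨δ n m, hδ n m, rfl⟩
  have hsbp : ∀ {x : List Bool} {n : ℕ} (G H : SimpleGraph (Fin n)), 0 < n →
      x = encodeGraph G ++ encodeGraph H → ∃ ψ : CNF (Fin n × Fin (n * n)),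
      IsCompleteSBP (rowColumnGroup n (n * n)) ψ ∧ u x = encodeCNF ψ := by
    intro x n G H hn hx
    have ho : order ![x, [], []] = n := order_eq_of_pair hx
    have hr : (rows ![x, [], []] : ℕ) = n := by rw [rows_eq (ho ▸ hn), ho]
    subst hr
    exact hcast _ _ (PNat.mul_coe _ _)
  -- A certificate has length `4 * (n * n) * (n * n)`, and `n` is at most the length of the input.
  refine ⟨4 * .X ^ 4, fun p => decide (Accept ![p.1, p.2, u p.1]), ?_, fun x => ?_⟩
  · refine nonempty_computable_of_call D (n := rows) (m := fun w => rows w * rows w)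
      (P := Accept) pt_order.pred.succ (pt_order.pred.succ.mul pt_order.pred.succ) ptp_accept ?_
    intro x c
    exact decide_eq_true_iff
  · simp only [decide_eq_true_iff]
    constructor
    · intro hx
      by_cases hpair : IsGraphPair ![x, [], []]
      · obtain ⟨G, H, hGH⟩ := exists_of_isGraphPair rfl hpair
        replace hGH : x = encodeGraph G ++ encodeGraph H := hGH
        have hiso : ¬Nonempty (G ≃g H) := fun hiso => hx ⟨_, _, G, H, hGH, hiso⟩
        have hn : 0 < order ![x, [], []] := by
          by_contra h0
          have : IsEmpty (Fin (order ![x, [], []])) := ⟨fun i => h0 i.pos⟩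
          exact hiso ⟨⟨Equiv.refl _, fun {a} => isEmptyElim a⟩⟩
        obtain ⟨ψ, hψ, hu⟩ := hsbp G H hn hGH
        obtain ⟨c, hc, hacc⟩ := exists_accept_of_not_iso hψ hn hiso hGH
        refine ⟨c, ?_, by rwa [hu]⟩
        have hle : order ![x, [], []] ≤ x.length := by
          have := congrArg List.length hGH
          rw [List.length_append, length_encodeGraph] at this
          have := Nat.le_mul_self (order ![x, [], []])
          omega
        rw [hc]
        simp only [Polynomial.eval_mul, Polynomial.eval_ofNat, Polynomial.eval_pow,
          Polynomial.eval_X]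
        calc _ ≤ 4 * (x.length * x.length * (x.length * x.length)) := by gcongr
          _ = 4 * x.length ^ 4 := by ring
      · exact ⟨[], Nat.zero_le _, Or.inl hpair⟩
    · rintro ⟨c, -, hacc⟩ ⟨n, k, G, H, hx, ⟨f⟩⟩
      obtain rfl : n = k := by simpa using Fintype.card_congr f.toEquiv
      rcases Nat.eq_zero_or_pos n with rfl | hn
      -- For graphs without vertices there is no format in `ℕ+`; acceptance already fails because
      -- the order must be positive.
      · rcases hacc with hacc | hacc
        · exact hacc (isGraphPair_of_eq hx)
        · have ho : order ![x, c, u x] = 0 := order_eq_of_pair hx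
          exact absurd hacc.1 (by rw [ho]; exact lt_irrefl 0)
      · obtain ⟨ψ, hψ, hu⟩ := hsbp G H hn hx
        exact not_accept_of_iso hψ hn ⟨f⟩ hx hu hacc

end SymBreak

theorem theorem1 (h : SymBreak.RowColumnSBPInPolyTime) : SymBreak.GI ∈ SymBreak.coNP := by
  exact SymBreak.gi_mem_coNP h
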